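/- Write $m=u-u_{xx}=\Delta u$ with $\Delta=1-D_x^2$, and for continuous functions $f,g:\mathbb R^2\to\mathbb R$ consider the $fg$-equation $$m_t+f(u,u_x)\,m+\big(g(u,u_x)\,m\big)_x=0 .$$ Say that it has the CH–mCH Hamiltonian structure if there is a functional $H(u)=\int_{-\infty}^{\infty} B(x,u,u_x,\dots,\partial_x^k u)\,dx$, with $B$ continuous and $k$ finite, such that identically for all smooth $u$ $$-f(u,u_x)m-\big(g(u,u_x)m\big)_x=-D_x\Delta\,(\delta H/\delta m)$$ (in the sense of distributions in $x$). Here $\delta H/\delta m=\psi$ means that $\psi$ is a $C^2$ function of $x$ with $\frac{d}{d\varepsilon}\int\big(B[u+\varepsilon\varphi]-B[u]\big)dx\big|_{\varepsilon=0}=\int \psi\,\Delta\varphi\,dx$ for all $\varphi\in C_c^\infty(\mathbb R)$, where $B[u]$ denotes $B$ evaluated along $u$. (a) The $fg$-equation has this structure if and only if $$f(u,u_x)=u_x f_1,\qquad g(u,u_x)=u f_1+g_1,$$ where $f_1$ and $g_1$ are functions of $u^2-u_x^2$ on each branch of its level sets, that is, $f_1=f_1^{+}(u^2-u_x^2)$,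 $g_1=g_1^{+}(u^2-u_x^2)$ for $u+u_x\ge 0$ and $f_1=f_1^{-}(u^2-u_x^2)$, $g_1=g_1^{-}(u^2-u_x^2)$ for $u+u_x<0$, with continuous $f_1^\pm,g_1^\pm:\mathbb R\to\mathbb R$ such that $f_1^+(0)=f_1^-(0)$ and $g_1^+(0)=g_1^-(0)$. If $g$ is $C^1$, then $g_1^\pm$ can moreover be taken to be $C^1$. (b) If $f$ and $g$ are real analytic on $\mathbb R^2$, then the $fg$-equation has this structure if and only if $$f(u,u_x)=u_x f_1(u^2-u_x^2),\qquad g(u,u_x)=u f_1(u^2-u_x^2)+g_1(u^2-u_x^2)$$ for a $C^0$ function $f_1$ and a $C^1$ function $g_1$ on $\mathbb R$. (c) For all continuous $f_1,g_1:\mathbb R\to\mathbb R$ (in particular, for $f_1\in C^0$ and $g_1\in C^1$), the equation of (b) has the structure $$m_t=-u_xf_1(u^2-u_x^2)m-\big((uf_1(u^2-u_x^2)+g_1(u^2-u_x^2))m\big)_x=-D_x\Delta(\delta H/\delta m)$$ with $$H(u)=\int_{-\infty}^{\infty}\tfrac12\big(F_1(u^2-u_x^2)+u\,\tilde G_1(u^2-u_x^2)\big)m\,dx,$$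 $$F_1(y)=\int_0^{y}f_1(t)\,dt=y\int_0^1 f_1(\lambda y)\,d\lambda,\qquad \tilde G_1(y)=\int_0^1 g_1(\lambda y)\,d\lambda=y^{-1}\int_0^{y}g_1(t)\,dt\ \ (y\neq0\text{ in the last expression}).$$ For Schwartz functions $u$ the integral $H(u)$ converges absolutely, and $\frac{d}{d\varepsilon}H(u+\varepsilon\varphi)|_{\varepsilon=0}=\int\psi\,\Delta\varphi\,dx$ for all Schwartz functions $\varphi$, with a bounded $C^2$ function $\psi=\delta H/\delta m$ satisfying the displayed identity. The same holds for the equations of (a), with $F_1^\pm$ and $\tilde G_1^\pm$ formed from $f_1^\pm$ and $g_1^\pm$ and used for $u+u_x\ge0$ and $u+u_x<0$ respectively. -/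

import Mathlib

open MeasureTheory
open scoped ContDiff SchwartzMap

noncomputable section

namespace CHmCH

/-- The operator `Δ = 1 - D_x²` on functions of one real variable; `helm u` is the momentum
`m = u - u_xx`. -/
def helm (u : ℝ → ℝ) (x : ℝ) : ℝ := u x - iteratedDeriv 2 u x

/-- The jet `(u, u_x, …, ∂_x^k u)` of order `k` of `u` at `x`. -/
def jet (k : ℕ) (u : ℝ → ℝ) (x : ℝ) : Fin (k + 1) → ℝ := fun i => iteratedDeriv (i : ℕ) u x

/-- Smooth compactly supported functions on the line. -/
def IsTest (φ : ℝ → ℝ) : Prop := ContDiff ℝ ∞ φ ∧ HasCompactSupport φ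

/-- The functional `H(u) = ∫ B(x, u, u_x, …, ∂_x^k u) dx` with density `B`. -/
def functional {k : ℕ} (B : ℝ → (Fin (k + 1) → ℝ) → ℝ) (u : ℝ → ℝ) : ℝ :=
  ∫ x, B x (jet k u x)

/-- `ψ` is a variational derivative `δH/δm` at `u` of `H = ∫ B dx`, where `u` is the potential of
`m = Δ u`: for every compactly supported smooth variation `δu = φ`, that is `δm = Δ φ`, the first
variation of `H` is `∫ ψ δm dx`. The difference `H(u + ε φ) - H(u)` is taken under the integral
sign, where the integrand has compact support, so that no decay of `u` is needed. -/
def IsVarDerivMomentum {k : ℕ} (B : ℝ → (Fin (k + 1) → ℝ) → ℝ) (u ψ : ℝ → ℝ) : Prop :=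
  ∀ φ : ℝ → ℝ, IsTest φ →
    HasDerivAt
      (fun ε : ℝ => ∫ x, (B x (jet k (fun y => u y + ε * φ y) x) - B x (jet k u x)))
      (∫ x, ψ x * helm φ x) 0

/-- The identity `f(u,u_x) m + (g(u,u_x) m)_x = D_x Δ ψ`, with `m = Δ u`, in the sense of
distributions on the line (`f` and `g` need not be differentiable). -/
def FlowEq (f g : ℝ → ℝ → ℝ) (u ψ : ℝ → ℝ) : Prop :=
  ∀ χ : ℝ → ℝ, IsTest χ →
    ∫ x, (f (u x) (deriv u x) * helm u x * χ x - g (u x) (deriv u x) * helm u x * deriv χ x)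
      = - ∫ x, helm ψ x * deriv χ x

/-- The equation `m_t + f(u,u_x) m + (g(u,u_x) m)_x = 0` takes the form
`m_t = - D_x Δ (δH/δm)` with `H = ∫ B dx`, identically in `u`. -/
def IsHamiltonianDensity (f g : ℝ → ℝ → ℝ) {k : ℕ} (B : ℝ → (Fin (k + 1) → ℝ) → ℝ) : Prop :=
  Continuous (Function.uncurry B) ∧
    ∀ u : ℝ → ℝ, ContDiff ℝ ∞ u →
      ∃ ψ : ℝ → ℝ, ContDiff ℝ 2 ψ ∧ IsVarDerivMomentum B u ψ ∧ FlowEq f g u ψ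

/-- The equation `m_t + f(u,u_x) m + (g(u,u_x) m)_x = 0` has the Hamiltonian structure
`m_t = - D_x Δ (δH/δm)` for some functional whose density is a continuous function of `x`, `u`
and finitely many `x`-derivatives of `u`. -/
def HasHamiltonianStructure (f g : ℝ → ℝ → ℝ) : Prop :=
  ∃ (k : ℕ) (B : ℝ → (Fin (k + 1) → ℝ) → ℝ), IsHamiltonianDensity f g B

/-- `H = ∫ B dx` gives the Hamiltonian structure as a genuine functional on the Schwartz space:
the integral converges, and `H` has at every `u` a bounded variational derivative `δH/δm`, with
respect to all Schwartz variations, for which `f m + (g m)_x = D_x Δ (δH/δm)`. -/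
def IsSchwartzHamiltonian (f g : ℝ → ℝ → ℝ) {k : ℕ} (B : ℝ → (Fin (k + 1) → ℝ) → ℝ) : Prop :=
  ∀ u : 𝓢(ℝ, ℝ),
    Integrable (fun x => B x (jet k u x)) ∧
    ∃ ψ : ℝ → ℝ, ContDiff ℝ 2 ψ ∧ (∃ C : ℝ, ∀ x, |ψ x| ≤ C) ∧
      (∀ φ : 𝓢(ℝ, ℝ),
        HasDerivAt (fun ε : ℝ => functional B (fun y => u y + ε * φ y))
          (∫ x, ψ x * helm φ x) 0) ∧
      FlowEq f g u ψ

/-- `F₁(y) = ∫_0^y f₁(t) dt`. -/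
def primitive (f₁ : ℝ → ℝ) (y : ℝ) : ℝ := ∫ t in (0 : ℝ)..y, f₁ t

/-- `G̃₁(y) = ∫_0^1 g₁(λ y) dλ`. -/
def average (g₁ : ℝ → ℝ) (y : ℝ) : ℝ := ∫ s in (0 : ℝ)..1, g₁ (s * y)

/-- The function `(u, v) ↦ h(u² - v²)`. -/
def ofInvariant (h : ℝ → ℝ) (u v : ℝ) : ℝ := h (u ^ 2 - v ^ 2)

/-- The function of `(u, v)` equal to `hp(u² - v²)` for `u + v ≥ 0` and to `hm(u² - v²)` for
`u + v < 0`. (Every level set of `u² - v²` has one branch on each side of the line `u + v = 0`.) -/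
def ofBranches (hp hm : ℝ → ℝ) (u v : ℝ) : ℝ :=
  if 0 ≤ u + v then hp (u ^ 2 - v ^ 2) else hm (u ^ 2 - v ^ 2)

/-- The density `½ (F(u,u_x) + u G(u,u_x)) m`. -/
def density (F G : ℝ → ℝ → ℝ) (_x : ℝ) (j : Fin (2 + 1) → ℝ) : ℝ :=
  1 / 2 * (F (j 0) (j 1) + j 0 * G (j 0) (j 1)) * (j 0 - j 2)

end CHmCH

end

open MeasureTheory
open scoped ContDiff SchwartzMap

noncomputable section

namespace CHmCH

/-! Put W = Δ(δH/δm) = δH/δu. The flow identity integrates to W = g m + ∂⁻¹(f m). So the structure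
asks for two things: that f m be the x-derivative of a local expression in u, and that the resulting
W be a first variation. Both are governed by D_x(u² - u_x²) = 2 u_x m. The functions with m = 0,
which are αeˣ + βe⁻ˣ, keep u² - u_x² and the sign of u + u_x constant, and u_x f₁(u² - u_x²) m is
the x-derivative of ½ F₁(u² - u_x²).

Sufficiency. Integration by parts gives ½(F₁ + u G̃₁) m the first variation W = (u f₁ + g₁) m + ½
F₁, whose x-derivative is the required right-hand side; ψ is then found by solving Δψ = W. For
merely continuous g₁ the function G̃₁ may fail to be differentiable at 0. The first variation is
therefore written in an integrated form free of derivatives of G̃₁, proved when g₁ is constant near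
0, and carried over by a limit (`integral_lag_sub`). On Schwartz functions the same formula on [-n,
n] is used as n → ∞.

Necessity for f. W u depends only on the germ of u (`IsHamiltonianDensity.exists_field`), so q = W -
g m is a local primitive of f m. A cutoff at scale δ → 0 shows that q sees only the 1-jet
(`local_primitive_eq_of_jet_eq`), hence q = p(u, u_x). Since q is constant when m = 0, p is a
function of u² - u_x² on each open half-plane, and differentiating across the hyperbolas gives f =
u_x f₁ (`exists_invariant_of_potential`).

Necessity for g. Subtracting the first variation already known for g₁ = 0 leaves (g - u f₁) m, which
is again a first variation up to no remainder. At a function with m = 0 its second variation is the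
operator k Δ, with k the value of g - u f₁ along that function; symmetry forces k to be constant
(`IsExactField.const_on_hyperbolas`), so g - u f₁ is constant on the branches.

In the analytic case the two branches are compared on lines parametrized by t = u² - v². One of
these lines changes branch at t = 0, and the identity theorem transports relations across that point
(`branches_eq_of_analytic`). -/

/-! ### Calculus of Δ and of test functions -/

theorem smooth_deriv {u : ℝ → ℝ} (hu : ContDiff ℝ ∞ u) : ContDiff ℝ ∞ (deriv u) :=
  (contDiff_infty_iff_deriv.1 hu).2

theorem smooth_hasDerivAt {u : ℝ → ℝ} (hu : ContDiff ℝ ∞ u) (x : ℝ) :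
    HasDerivAt u (deriv u x) x :=
  ((contDiff_infty_iff_deriv.1 hu).1 x).hasDerivAt

theorem helm_eq (u : ℝ → ℝ) (x : ℝ) : helm u x = u x - deriv (deriv u) x := by
  simp [helm, iteratedDeriv_succ]

theorem continuous_helm_of_contDiff_two {u : ℝ → ℝ} (hu : ContDiff ℝ 2 u) :
    Continuous (helm u) := by
  unfold helm
  exact hu.continuous.sub (hu.continuous_iteratedDeriv 2 le_rfl)

theorem continuous_helm {u : ℝ → ℝ} (hu : ContDiff ℝ ∞ u) : Continuous (helm u) :=
  continuous_helm_of_contDiff_two (contDiff_infty.1 hu 2)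

theorem IsTest.deriv {φ : ℝ → ℝ} (h : IsTest φ) : IsTest (deriv φ) :=
  ⟨smooth_deriv h.1, h.2.deriv⟩

theorem IsTest.mul_left {φ u : ℝ → ℝ} (h : IsTest φ) (hu : ContDiff ℝ ∞ u) :
    IsTest (fun x => u x * φ x) :=
  ⟨hu.mul h.1, h.2.mul_left⟩

theorem IsTest.const_mul {φ : ℝ → ℝ} (h : IsTest φ) (c : ℝ) : IsTest (fun x => c * φ x) :=
  h.mul_left contDiff_const

theorem IsTest.add {φ χ : ℝ → ℝ} (h : IsTest φ) (h' : IsTest χ) :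
    IsTest (fun x => φ x + χ x) :=
  ⟨h.1.add h'.1, h.2.add h'.2⟩

theorem IsTest.exists_bound {φ : ℝ → ℝ} (h : IsTest φ) :
    ∃ R : ℝ, 0 < R ∧ ∀ x, x ∉ Set.Ioo (-R) R → x ∉ tsupport φ := by
  obtain ⟨R, hR⟩ := h.2.isCompact.isBounded.subset_ball (0 : ℝ)
  refine ⟨max R 1, by positivity, fun x hx hx' => hx ?_⟩
  have := hR hx'
  rw [Metric.mem_ball, dist_zero_right, Real.norm_eq_abs, abs_lt] at this
  exact ⟨by linarith [le_max_left R 1], by linarith [le_max_left R 1]⟩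

theorem eq_zero_of_notMem_tsupport {φ : ℝ → ℝ} {x : ℝ} (hx : x ∉ tsupport φ) :
    φ x = 0 ∧ deriv φ x = 0 ∧ helm φ x = 0 := by
  have h1 : φ x = 0 := image_eq_zero_of_notMem_tsupport hx
  have h2 : deriv φ x = 0 :=
    image_eq_zero_of_notMem_tsupport fun h => hx (tsupport_deriv_subset (f := φ) h)
  have h3 : deriv (deriv φ) x = 0 :=
    image_eq_zero_of_notMem_tsupport fun h =>
      hx (tsupport_deriv_subset (f := φ) (tsupport_deriv_subset (f := deriv φ) h))
  exact ⟨h1, h2, by rw [helm_eq, h1, h3, sub_zero]⟩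

theorem integral_eq_zero_of_hasCompactSupport {k k' : ℝ → ℝ} (hk : ∀ x, HasDerivAt k (k' x) x)
    (hk' : Continuous k') (hs : HasCompactSupport k) : ∫ x, k' x = 0 := by
  have e : k' = deriv k := funext fun x => (hk x).deriv.symm
  have hs' : HasCompactSupport k' := e ▸ hs.deriv
  exact integral_eq_zero_of_hasDerivAt_of_integrable hk (hk'.integrable_of_hasCompactSupport hs')
    ((continuous_iff_continuousAt.2 fun x => (hk x).continuousAt).integrable_of_hasCompactSupport hs)

theorem integral_eq_intervalIntegral {k : ℝ → ℝ} {R : ℝ} (hR : 0 < R)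
    (h : ∀ x, x ∉ Set.Ioo (-R) R → k x = 0) : ∫ x, k x = ∫ x in (-R)..R, k x := by
  rw [intervalIntegral.integral_of_le (by linarith), setIntegral_eq_integral_of_forall_compl_eq_zero]
  exact fun x hx => h x fun hx' => hx (Set.Ioo_subset_Ioc_self hx')

/-! ### Weak identities and Green's formula -/

/-- A continuous function which vanishes weakly on an open set vanishes there. -/
theorem eq_zero_of_integral_test_eq_zero {d : ℝ → ℝ} (hd : Continuous d) {U : Set ℝ}
    (hU : IsOpen U) (h : ∀ φ, IsTest φ → tsupport φ ⊆ U → ∫ x, d x * φ x = 0) :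
    ∀ x ∈ U, d x = 0 := by
  have hae := hU.ae_eq_zero_of_integral_contDiff_smul_eq_zero (μ := volume) (f := d)
    (hd.locallyIntegrable.locallyIntegrableOn U) (fun φ h1 h2 h3 => by
      rw [← h φ ⟨h1, h2⟩ h3]; simp [mul_comm])
  intro x hx
  by_contra hne
  have hV : IsOpen (U ∩ {x | d x ≠ 0}) := hU.inter (isOpen_ne_fun hd continuous_const)
  have hpos := hV.measure_pos volume ⟨x, hx, hne⟩
  refine hpos.ne' (measure_mono_null ?_ hae)
  rintro z ⟨h1, h2⟩ h3
  exact h2 (h3 h1)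

theorem exists_test_eq_one {R : ℝ} (hR : 0 < R) :
    ∃ η : ℝ → ℝ, IsTest η ∧ (∀ x, |x| ≤ R → η x = 1) := by
  let b : ContDiffBump (0 : ℝ) := ⟨R, R + 1, hR, by linarith⟩
  refine ⟨b, ⟨b.contDiff, b.hasCompactSupport⟩, fun x hx => b.one_of_mem_closedBall ?_⟩
  simpa using hx

/-- Du Bois-Reymond: a continuous function with vanishing weak derivative is constant. -/
theorem eq_const_of_integral_deriv_test_eq_zero {k : ℝ → ℝ} (hk : Continuous k)
    (h : ∀ χ, IsTest χ → ∫ x, k x * deriv χ x = 0) : ∃ c, ∀ x, k x = c := by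
  let b : ContDiffBump (0 : ℝ) := ⟨1, 2, one_pos, by norm_num⟩
  set ρ : ℝ → ℝ := b.normed volume with hρ
  have hρt : IsTest ρ := ⟨b.contDiff_normed, b.hasCompactSupport_normed⟩
  have hρ1 : ∫ x, ρ x = 1 := b.integral_normed
  have hint : ∀ {φ : ℝ → ℝ}, IsTest φ → Integrable φ :=
    fun hφ => hφ.1.continuous.integrable_of_hasCompactSupport hφ.2
  have hint' : ∀ {φ : ℝ → ℝ}, IsTest φ → Integrable (fun x => k x * φ x) :=
    fun hφ => (hk.mul hφ.1.continuous).integrable_of_hasCompactSupport hφ.2.mul_left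
  refine ⟨∫ x, k x * ρ x, fun x => ?_⟩
  rw [← sub_eq_zero]
  refine eq_zero_of_integral_test_eq_zero (d := fun x => k x - ∫ x, k x * ρ x) (U := Set.univ)
    (hk.sub continuous_const) isOpen_univ ?_ x trivial
  intro φ hφ _
  set I := ∫ x, φ x with hI
  -- Subtracting the multiple of `ρ` with the same integral makes `η` of mean zero, so its
  -- antiderivative from `-R` has compact support and is an admissible test function.
  have hη : IsTest (fun x => φ x + (-I) * ρ x) := hφ.add (hρt.const_mul _)
  set η : ℝ → ℝ := fun x => φ x + (-I) * ρ x with hηdef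
  obtain ⟨R, hR, hRs⟩ := hη.exists_bound
  have hη0 : ∀ x, x ∉ Set.Ioo (-R) R → η x = 0 := fun x hx =>
    image_eq_zero_of_notMem_tsupport (hRs x hx)
  have hηI : ∫ x, η x = 0 := by
    rw [hηdef, integral_add (hint hφ) (hint (hρt.const_mul _)), integral_const_mul, hρ1]
    ring
  have hηR : ∫ x in (-R)..R, η x = 0 := by
    rw [← integral_eq_intervalIntegral hR hη0, hηI]
  have hd : ∀ x, HasDerivAt (fun x => ∫ t in (-R)..x, η t) (η x) x := fun x =>
    hη.1.continuous.integral_hasStrictDerivAt _ _ |>.hasDerivAt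
  have hde : deriv (fun x => ∫ t in (-R)..x, η t) = η := funext fun x => (hd x).deriv
  have hχ : IsTest (fun x => ∫ t in (-R)..x, η t) := by
    refine ⟨contDiff_infty_iff_deriv.2 ⟨fun x => (hd x).differentiableAt, by rw [hde]; exact hη.1⟩, ?_⟩
    refine HasCompactSupport.intro (isCompact_Icc (a := -R) (b := R)) fun x hx => ?_
    rw [Set.mem_Icc, not_and_or, not_le, not_le] at hx
    rcases hx with hx | hx
    · rw [intervalIntegral.integral_zero_ae]
      refine Filter.Eventually.of_forall fun t ht => hη0 t fun h' => ?_
      rw [Set.uIoc_of_ge hx.le] at ht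
      linarith [h'.1, ht.2]
    · rw [← intervalIntegral.integral_add_adjacent_intervals (b := R)
        (hη.1.continuous.intervalIntegrable _ _) (hη.1.continuous.intervalIntegrable _ _), hηR,
        zero_add, intervalIntegral.integral_zero_ae]
      refine Filter.Eventually.of_forall fun t ht => hη0 t fun h' => ?_
      rw [Set.uIoc_of_le hx.le] at ht
      linarith [h'.2, ht.1]
  have key := h _ hχ
  rw [hde] at key
  have e1 : (fun x => k x * η x) = fun x => k x * φ x + (-I) * (k x * ρ x) := by
    funext x; simp only [hηdef]; ring
  rw [e1, integral_add (hint' hφ) ((hint' hρt).const_mul _), integral_const_mul] at key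
  have e2 : (fun x => (k x - ∫ x, k x * ρ x) * φ x)
      = fun x => k x * φ x + (-(∫ x, k x * ρ x)) * φ x := by funext x; ring
  rw [e2, integral_add (hint' hφ) ((hint hφ).const_mul _), integral_const_mul]
  linarith

/-- Green's formula for `Δ = 1 - D²`. -/
theorem integral_mul_helm {ψ φ : ℝ → ℝ} (hψ : ContDiff ℝ 2 ψ) (hφ : IsTest φ) :
    ∫ x, ψ x * helm φ x = ∫ x, helm ψ x * φ x := by
  have hψ1 : ∀ x, HasDerivAt ψ (deriv ψ x) x := fun x =>
    (hψ.differentiable (by norm_num) x).hasDerivAt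
  have hψ2' : ContDiff ℝ 1 (deriv ψ) := (contDiff_succ_iff_deriv (n := 1).1 hψ).2.2
  have hψ2 : ∀ x, HasDerivAt (deriv ψ) (deriv (deriv ψ) x) x := fun x =>
    (hψ2'.differentiable (by norm_num) x).hasDerivAt
  have hc := continuous_helm hφ.1
  have hc' := continuous_helm_of_contDiff_two hψ
  have key : ∫ x, (helm ψ x * φ x - ψ x * helm φ x) = 0 := by
    refine integral_eq_zero_of_hasCompactSupport (k := fun x => ψ x * deriv φ x - deriv ψ x * φ x)
      (fun x => ?_) ?_ (hφ.deriv.2.mul_left.sub hφ.2.mul_left)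
    · refine (((hψ1 x).mul (smooth_hasDerivAt (smooth_deriv hφ.1) x)).sub
        ((hψ2 x).mul (smooth_hasDerivAt hφ.1 x))).congr_deriv ?_
      rw [helm_eq, helm_eq]; ring
    · exact (hc'.mul hφ.1.continuous).sub (hψ.continuous.mul hc)
  rw [integral_sub] at key
  · linarith
  · exact (hc'.mul hφ.1.continuous).integrable_of_hasCompactSupport hφ.2.mul_left
  · refine (hψ.continuous.mul hc).integrable_of_hasCompactSupport ?_
    refine HasCompactSupport.mul_left ?_
    exact HasCompactSupport.intro hφ.2 fun x hx => (eq_zero_of_notMem_tsupport hx).2.2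

/-! ### Functions of u² - v² on the two branches -/

theorem ofBranches_self (h : ℝ → ℝ) : ofBranches h h = ofInvariant h := by
  funext u v
  simp [ofBranches, ofInvariant]

/-- The formula switches only on the line `u + v = 0`, where `u² - v² = 0`; agreement at `0` is all
that the gluing needs. The parameter `z` in `hp` and `hm` serves the regularization in `δ` below. -/
theorem continuous_ofBranches_comp {X : Type*} [TopologicalSpace X] {hp hm : X → ℝ → ℝ}
    {u v : X → ℝ} (hu : Continuous u) (hv : Continuous v)
    (hhp : Continuous fun z => hp z (u z ^ 2 - v z ^ 2))
    (hhm : Continuous fun z => hm z (u z ^ 2 - v z ^ 2)) (h0 : ∀ z, hp z 0 = hm z 0) :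
    Continuous fun z => ofBranches (hp z) (hm z) (u z) (v z) := by
  unfold ofBranches
  refine Continuous.if_le hhp hhm continuous_const (hu.add hv) fun z hz => ?_
  have : u z ^ 2 - v z ^ 2 = 0 := by
    have : u z ^ 2 - v z ^ 2 = (u z + v z) * (u z - v z) := by ring
    rw [this, ← hz, zero_mul]
  rw [this, h0]

theorem continuous_ofBranches {hp hm : ℝ → ℝ} (hhp : Continuous hp) (hhm : Continuous hm)
    (h0 : hp 0 = hm 0) : Continuous (Function.uncurry (ofBranches hp hm)) :=
  continuous_ofBranches_comp (hp := fun _ => hp) (hm := fun _ => hm) continuous_fst continuous_snd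
    (by fun_prop) (by fun_prop) fun _ => h0

/-- The function `F` of two variables has the gradient of a function of `u² - v²` whose derivative
with respect to `u² - v²` is `f`. -/
def HasInvariantDeriv (F f : ℝ → ℝ → ℝ) : Prop :=
  ∀ (a b : ℝ → ℝ) (a' b' t : ℝ), HasDerivAt a a' t → HasDerivAt b b' t →
    HasDerivAt (fun t => F (a t) (b t)) (f (a t) (b t) * (2 * a t * a' - 2 * b t * b')) t

/-- Off the line `u + v = 0` this is the chain rule for one branch. On it `u² - v² = 0`, where both
branches have the same value and the same derivative, so the derivatives within the two sides of the
line combine to a full one. -/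
theorem hasInvariantDeriv_ofBranches {hp hm hp' hm' : ℝ → ℝ} (hhp : ∀ y, HasDerivAt hp (hp' y) y)
    (hhm : ∀ y, HasDerivAt hm (hm' y) y) (h0 : hp 0 = hm 0) (h0' : hp' 0 = hm' 0) :
    HasInvariantDeriv (ofBranches hp hm) (ofBranches hp' hm') := by
  intro a b a' b' t ha hb
  have hy : HasDerivAt (fun t => a t ^ 2 - b t ^ 2) (2 * a t * a' - 2 * b t * b') t := by
    exact ((ha.pow 2).sub (hb.pow 2)).congr_deriv (by simp)
  have dp := (hhp (a t ^ 2 - b t ^ 2)).comp t hy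
  have dm := (hhm (a t ^ 2 - b t ^ 2)).comp t hy
  have hc : ContinuousAt (fun t => a t + b t) t := (ha.add hb).continuousAt
  rcases lt_trichotomy (a t + b t) 0 with h | h | h
  · have e : ∀ᶠ s in nhds t, a s + b s < 0 := hc.eventually (gt_mem_nhds h)
    have := dm.congr_of_eventuallyEq (f₁ := fun t => ofBranches hp hm (a t) (b t)) (by
      filter_upwards [e] with s hs
      simp [ofBranches, not_le.2 hs])
    simpa [ofBranches, not_le.2 h] using this
  · have hy0 : a t ^ 2 - b t ^ 2 = 0 := by
      have : a t ^ 2 - b t ^ 2 = (a t + b t) * (a t - b t) := by ring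
      rw [this, h, zero_mul]
    have e1 : ofBranches hp' hm' (a t) (b t) = hp' (a t ^ 2 - b t ^ 2) := by
      simp [ofBranches, h]
    have e2 : hm' (a t ^ 2 - b t ^ 2) = hp' (a t ^ 2 - b t ^ 2) := by rw [hy0, h0']
    rw [e1]
    rw [e2] at dm
    have w1 : HasDerivWithinAt (fun t => ofBranches hp hm (a t) (b t))
        (hp' (a t ^ 2 - b t ^ 2) * (2 * a t * a' - 2 * b t * b')) {s | 0 ≤ a s + b s} t :=
      dp.hasDerivWithinAt.congr (fun s hs => by
        simp only [Set.mem_ofPred_eq] at hs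
        simp [ofBranches, hs]) (by simp [ofBranches, h])
    have w2 : HasDerivWithinAt (fun t => ofBranches hp hm (a t) (b t))
        (hp' (a t ^ 2 - b t ^ 2) * (2 * a t * a' - 2 * b t * b')) {s | a s + b s < 0} t :=
      dm.hasDerivWithinAt.congr (fun s hs => by
        simp only [Set.mem_ofPred_eq] at hs
        simp [ofBranches, not_le.2 hs]) (by simp [ofBranches, h, hy0, h0])
    have := w1.union w2
    rwa [show {s | 0 ≤ a s + b s} ∪ {s | a s + b s < 0} = Set.univ by
      ext s; simp [le_or_gt], hasDerivWithinAt_univ] at this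
  · have e : ∀ᶠ s in nhds t, 0 < a s + b s := hc.eventually (lt_mem_nhds h)
    have := dp.congr_of_eventuallyEq (f₁ := fun t => ofBranches hp hm (a t) (b t)) (by
      filter_upwards [e] with s hs
      simp [ofBranches, hs.le])
    simpa [ofBranches, h.le] using this

/-! ### First variation for differentiable coefficients -/

/-- The density `½ (F + u G) (u - u_xx)` as a function of the `2`-jet. -/
def lag (F G : ℝ → ℝ → ℝ) (a b c : ℝ) : ℝ := 1 / 2 * (F a b + a * G a b) * (a - c)

/-- The variational derivative `(u f + g) (u - u_xx) + ½ F` as a function of the `2`-jet. -/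
def varDeriv (f g F : ℝ → ℝ → ℝ) (a b c : ℝ) : ℝ :=
  (a * f a b + g a b) * (a - c) + 1 / 2 * F a b

/-- The boundary term in the first variation of `lag`. -/
def bdry (F G : ℝ → ℝ → ℝ) (a b p p' : ℝ) : ℝ :=
  -(1 / 2) * (F a b + a * G a b) * p' + 1 / 2 * b * G a b * p

theorem continuous_uncurry_comp {X : Type*} [TopologicalSpace X] {F : ℝ → ℝ → ℝ}
    (hF : Continuous (Function.uncurry F)) {a b : X → ℝ} (ha : Continuous a) (hb : Continuous b) :
    Continuous fun z => F (a z) (b z) :=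
  hF.comp (ha.prodMk hb)

/-- The first variation of `lag` in integrated form, for differentiable coefficients. -/
theorem integral_lag_sub_of_hasInvariantDeriv {F f G k g : ℝ → ℝ → ℝ}
    (hf : Continuous (Function.uncurry f)) (hF : Continuous (Function.uncurry F))
    (hG : Continuous (Function.uncurry G)) (hk : Continuous (Function.uncurry k))
    (hFf : HasInvariantDeriv F f) (hGk : HasInvariantDeriv G k)
    (hg : ∀ u v, (u ^ 2 - v ^ 2) * k u v + G u v = g u v)
    {u φ : ℝ → ℝ} (hu : ContDiff ℝ ∞ u) (hφ : ContDiff ℝ ∞ φ) (a b ε : ℝ) :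
    ∫ x in a..b, (lag F G (u x + ε * φ x) (deriv u x + ε * deriv φ x)
        (deriv (deriv u) x + ε * deriv (deriv φ) x) - lag F G (u x) (deriv u x) (deriv (deriv u) x))
      = ∫ s in (0 : ℝ)..ε, ((∫ x in a..b, varDeriv f g F (u x + s * φ x) (deriv u x + s * deriv φ x)
          (deriv (deriv u) x + s * deriv (deriv φ) x) * φ x)
        + (bdry F G (u b + s * φ b) (deriv u b + s * deriv φ b) (φ b) (deriv φ b)
          - bdry F G (u a + s * φ a) (deriv u a + s * deriv φ a) (φ a) (deriv φ a))) := by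
  have hu' := smooth_deriv hu
  have hu'' := smooth_deriv hu'
  have hφ' := smooth_deriv hφ
  have hφ'' := smooth_deriv hφ'
  have cu := hu.continuous
  have cu' := hu'.continuous
  have cu'' := hu''.continuous
  have cφ := hφ.continuous
  have cφ' := hφ'.continuous
  have cφ'' := hφ''.continuous
  have du := smooth_hasDerivAt hu
  have du' := smooth_hasDerivAt hu'
  have dφ := smooth_hasDerivAt hφ
  have dφ' := smooth_hasDerivAt hφ'
  let U : ℝ → ℝ → ℝ := fun s x => u x + s * φ x
  let V : ℝ → ℝ → ℝ := fun s x => deriv u x + s * deriv φ x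
  let Z : ℝ → ℝ → ℝ := fun s x => deriv (deriv u) x + s * deriv (deriv φ) x
  let Ls : ℝ → ℝ → ℝ := fun s x =>
    1 / 2 * (f (U s x) (V s x) * (2 * U s x * φ x - 2 * V s x * deriv φ x)
      + (φ x * G (U s x) (V s x)
        + U s x * (k (U s x) (V s x) * (2 * U s x * φ x - 2 * V s x * deriv φ x))))
      * (U s x - Z s x)
    + 1 / 2 * (F (U s x) (V s x) + U s x * G (U s x) (V s x)) * (φ x - deriv (deriv φ) x)
  -- Integration by parts in divergence form: `bx` is the `s`-derivative of the density minus its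
  -- Euler-Lagrange part, and `dbx` shows that it is the `x`-derivative of the boundary term.
  let bx : ℝ → ℝ → ℝ := fun s x =>
    Ls s x - varDeriv f g F (U s x) (V s x) (Z s x) * φ x
  have cU : Continuous fun z : ℝ × ℝ => U z.1 z.2 := by fun_prop
  have cV : Continuous fun z : ℝ × ℝ => V z.1 z.2 := by fun_prop
  have cZ : Continuous fun z : ℝ × ℝ => Z z.1 z.2 := by fun_prop
  have cF := continuous_uncurry_comp hF cU cV
  have cf := continuous_uncurry_comp hf cU cV
  have cG := continuous_uncurry_comp hG cU cV
  have ck := continuous_uncurry_comp hk cU cV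
  have cLs : Continuous fun z : ℝ × ℝ => Ls z.1 z.2 := by
    simp only [Ls]; fun_prop
  have cW : Continuous fun z : ℝ × ℝ => varDeriv f g F (U z.1 z.2) (V z.1 z.2) (Z z.1 z.2) * φ z.2 := by
    simp only [varDeriv, ← hg]; fun_prop
  have cbx : Continuous fun z : ℝ × ℝ => bx z.1 z.2 := by
    exact cLs.sub cW
  have dLs : ∀ x s, HasDerivAt (fun s => lag F G (U s x) (V s x) (Z s x)) (Ls s x) s := by
    intro x s
    have dU : HasDerivAt (fun s => U s x) (φ x) s := by
      simpa [U] using ((hasDerivAt_id s).mul_const (φ x)).const_add (u x)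
    have dV : HasDerivAt (fun s => V s x) (deriv φ x) s := by
      simpa [V] using ((hasDerivAt_id s).mul_const (deriv φ x)).const_add (deriv u x)
    have dZ : HasDerivAt (fun s => Z s x) (deriv (deriv φ) x) s := by
      simpa [Z] using ((hasDerivAt_id s).mul_const (deriv (deriv φ) x)).const_add (deriv (deriv u) x)
    have := (((hFf _ _ _ _ s dU dV).add (dU.mul (hGk _ _ _ _ s dU dV))).const_mul (1 / 2)).mul
      (dU.sub dZ)
    exact this
  have dbx : ∀ s x, HasDerivAt
      (fun x => bdry F G (U s x) (V s x) (φ x) (deriv φ x)) (bx s x) x := by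
    intro s x
    have dU : HasDerivAt (fun x => U s x) (V s x) x := (du x).add ((dφ x).const_mul s)
    have dV : HasDerivAt (fun x => V s x) (Z s x) x := (du' x).add ((dφ' x).const_mul s)
    have dF := hFf _ _ _ _ x dU dV
    have dG := hGk _ _ _ _ x dU dV
    have := (((dF.add (dU.mul dG)).const_mul (-(1 / 2))).mul (dφ' x)).add
      (((dV.const_mul (1 / 2)).mul dG).mul (dφ x))
    refine this.congr_deriv ?_
    -- The relation `(u² - v²) k + G = g` absorbs the derivative `k` of `G`, so that neither
    -- `varDeriv` nor `bdry` contains it. This is what permits the later passage to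
    -- nondifferentiable `G`.
    simp only [bx, Ls, varDeriv, ← hg, Pi.add_apply, Pi.mul_apply]
    ring
  have step1 : ∀ x, lag F G (U ε x) (V ε x) (Z ε x) - lag F G (u x) (deriv u x) (deriv (deriv u) x)
      = ∫ s in (0 : ℝ)..ε, Ls s x := by
    intro x
    rw [intervalIntegral.integral_eq_sub_of_hasDerivAt (fun s _ => dLs x s)
      ((cLs.comp (continuous_id.prodMk continuous_const)).intervalIntegrable _ _)]
    simp [U, V, Z]
  have step2 : ∀ s, ∫ x in a..b, Ls s x
      = (∫ x in a..b, varDeriv f g F (U s x) (V s x) (Z s x) * φ x)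
        + (bdry F G (U s b) (V s b) (φ b) (deriv φ b)
          - bdry F G (U s a) (V s a) (φ a) (deriv φ a)) := by
    intro s
    have i1 : IntervalIntegrable (fun x => varDeriv f g F (U s x) (V s x) (Z s x) * φ x)
        volume a b := (cW.comp (continuous_const.prodMk continuous_id)).intervalIntegrable _ _
    have i2 : IntervalIntegrable (fun x => bx s x) volume a b :=
      (cbx.comp (continuous_const.prodMk continuous_id)).intervalIntegrable _ _
    rw [← intervalIntegral.integral_eq_sub_of_hasDerivAt (fun x _ => dbx s x) i2,
      ← intervalIntegral.integral_add i1 i2]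
    refine intervalIntegral.integral_congr fun x _ => ?_
    simp only [bx]; ring
  calc _ = ∫ x in a..b, ∫ s in (0 : ℝ)..ε, Ls s x :=
        intervalIntegral.integral_congr fun x _ => step1 x
    _ = ∫ s in (0 : ℝ)..ε, ∫ x in a..b, Ls s x := by
        refine intervalIntegral_intervalIntegral_swap ?_
        exact ((cLs.comp continuous_swap).continuousOn.integrableOn_compact
          (isCompact_uIcc.prod isCompact_uIcc)).mono_set
          (Set.prod_mono Set.uIoc_subset_uIcc Set.uIoc_subset_uIcc)
    _ = _ := intervalIntegral.integral_congr fun s _ => step2 s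

/-! ### Regularization for merely continuous g₁ -/

/-- The function `g` with its argument shrunk by `δ`, constant on `[-δ, δ]`. -/
def shrink (g : ℝ → ℝ) (δ y : ℝ) : ℝ := g (y - max (-δ) (min δ y))

theorem shrink_zero (g : ℝ → ℝ) : shrink g 0 = g := by
  funext y
  have : max (-(0 : ℝ)) (min 0 y) = 0 := by simp
  rw [shrink, this, sub_zero]

theorem shrink_apply_zero (g : ℝ → ℝ) {δ : ℝ} (hδ : 0 ≤ δ) : shrink g δ 0 = g 0 := by
  simp [shrink, hδ]

theorem continuous_shrink {g : ℝ → ℝ} (hg : Continuous g) :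
    Continuous fun z : ℝ × ℝ => shrink g z.1 z.2 := by
  unfold shrink; fun_prop

theorem shrink_of_abs_le (g : ℝ → ℝ) {δ y : ℝ} (hy : |y| ≤ δ) : shrink g δ y = g 0 := by
  rw [abs_le] at hy
  simp [shrink, min_eq_right hy.2, max_eq_right hy.1]

theorem continuous_average_comp {X : Type*} [TopologicalSpace X]
    [FirstCountableTopology X] [LocallyCompactSpace X] {g : X → ℝ → ℝ}
    (hg : Continuous (Function.uncurry g)) {y : X → ℝ} (hy : Continuous y) :
    Continuous fun z => average (g z) (y z) := by
  unfold average
  refine intervalIntegral.continuous_parametric_intervalIntegral_of_continuous'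
    (f := fun z s => g z (s * y z)) ?_ _ _
  exact hg.comp (continuous_fst.prodMk (continuous_snd.mul (hy.comp continuous_fst)))

theorem continuous_average {g : ℝ → ℝ} (hg : Continuous g) : Continuous (average g) :=
  continuous_average_comp (g := fun _ : ℝ => g) (hg.comp continuous_snd) continuous_id

theorem average_zero (g : ℝ → ℝ) : average g 0 = g 0 := by simp [average]

theorem mul_average (g : ℝ → ℝ) (y : ℝ) : y * average g y = ∫ t in (0 : ℝ)..y, g t := by
  simp [average]

theorem hasDerivAt_primitive {f : ℝ → ℝ} (hf : Continuous f) (y : ℝ) :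
    HasDerivAt (primitive f) (f y) y :=
  (hf.integral_hasStrictDerivAt 0 y).hasDerivAt

theorem primitive_zero (f : ℝ → ℝ) : primitive f 0 = 0 := by simp [primitive]

theorem continuous_primitive {f : ℝ → ℝ} (hf : Continuous f) : Continuous (primitive f) :=
  continuous_iff_continuousAt.2 fun y => (hasDerivAt_primitive hf y).continuousAt

theorem average_eq_of_abs_le {g : ℝ → ℝ} {δ y : ℝ} (hy : |y| ≤ δ) :
    average (shrink g δ) y = g 0 := by
  unfold average
  rw [intervalIntegral.integral_congr (g := fun _ => g 0), intervalIntegral.integral_const]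
  · simp
  · intro s hs
    rw [Set.uIcc_of_le zero_le_one] at hs
    refine shrink_of_abs_le g (le_trans ?_ hy)
    rw [abs_mul, abs_of_nonneg hs.1]
    exact mul_le_of_le_one_left (abs_nonneg _) hs.2

/-- Away from `0` the average is a primitive divided by `y`. On `[-δ, δ]` it is constant, and the
stated derivative has the right value at `y = 0` because division by zero gives `0`. -/
theorem hasDerivAt_average_shrink {g : ℝ → ℝ} (hg : Continuous g) {δ : ℝ} (hδ : 0 < δ) (y : ℝ) :
    HasDerivAt (average (shrink g δ)) ((shrink g δ y - average (shrink g δ) y) / y) y := by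
  rcases eq_or_ne y 0 with rfl | hy
  · rw [div_zero]
    refine (hasDerivAt_const (0 : ℝ) (g 0)).congr_of_eventuallyEq ?_
    filter_upwards [Metric.closedBall_mem_nhds (0 : ℝ) hδ] with z hz
    exact average_eq_of_abs_le (by simpa using hz)
  · have hc : Continuous (shrink g δ) := (continuous_shrink hg).comp (Continuous.prodMk_right δ)
    have := (hasDerivAt_primitive hc y).div (hasDerivAt_id y) hy
    refine (this.congr_of_eventuallyEq ?_).congr_deriv ?_
    · filter_upwards [isOpen_ne.mem_nhds hy] with z hz
      rw [Pi.div_apply, primitive, ← mul_average, id, mul_div_cancel_left₀ _ hz]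
    · simp only [primitive, ← mul_average, id]
      field_simp

theorem continuous_deriv_average_shrink {g : ℝ → ℝ} (hg : Continuous g) {δ : ℝ} (hδ : 0 < δ) :
    Continuous fun y => (shrink g δ y - average (shrink g δ) y) / y := by
  have hc : Continuous (shrink g δ) := (continuous_shrink hg).comp (Continuous.prodMk_right δ)
  rw [continuous_iff_continuousAt]
  intro y
  rcases eq_or_ne y 0 with rfl | hy
  · refine (continuousAt_const (y := (0 : ℝ))).congr ?_
    filter_upwards [Metric.closedBall_mem_nhds (0 : ℝ) hδ] with z hz
    have hz : |z| ≤ δ := by simpa using hz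
    rw [average_eq_of_abs_le hz, shrink_of_abs_le g hz, sub_self, zero_div]
  · exact (hc.continuousAt.sub (continuous_average hc).continuousAt).div continuousAt_id hy

/-- The first variation of the density `½ (F + u G) m` in integrated form. -/
theorem integral_lag_sub {fp fm gp gm : ℝ → ℝ} (hfp : Continuous fp) (hfm : Continuous fm)
    (hgp : Continuous gp) (hgm : Continuous gm) (hf0 : fp 0 = fm 0) (hg0 : gp 0 = gm 0)
    {u φ : ℝ → ℝ} (hu : ContDiff ℝ ∞ u) (hφ : ContDiff ℝ ∞ φ) (a b ε : ℝ) :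
    let F := ofBranches (primitive fp) (primitive fm)
    let G := ofBranches (average gp) (average gm)
    let f := ofBranches fp fm
    let g := ofBranches gp gm
    ∫ x in a..b, (lag F G (u x + ε * φ x) (deriv u x + ε * deriv φ x)
        (deriv (deriv u) x + ε * deriv (deriv φ) x) - lag F G (u x) (deriv u x) (deriv (deriv u) x))
      = ∫ s in (0 : ℝ)..ε, ((∫ x in a..b, varDeriv f g F (u x + s * φ x) (deriv u x + s * deriv φ x)
          (deriv (deriv u) x + s * deriv (deriv φ) x) * φ x)
        + (bdry F G (u b + s * φ b) (deriv u b + s * deriv φ b) (φ b) (deriv φ b)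
          - bdry F G (u a + s * φ a) (deriv u a + s * deriv φ a) (φ a) (deriv φ a))) := by
  intro F G f g
  have cu := hu.continuous
  have cu' := (smooth_deriv hu).continuous
  have cu'' := (smooth_deriv (smooth_deriv hu)).continuous
  have cφ := hφ.continuous
  have cφ' := (smooth_deriv hφ).continuous
  have cφ'' := (smooth_deriv (smooth_deriv hφ)).continuous
  have cF : Continuous (Function.uncurry F) :=
    continuous_ofBranches (continuous_primitive hfp) (continuous_primitive hfm)
      (by rw [primitive_zero, primitive_zero])
  have cf : Continuous (Function.uncurry f) := continuous_ofBranches hfp hfm hf0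
  -- regularize `gp`, `gm` by `max δ 0`
  let gd : ℝ → ℝ → ℝ → ℝ := fun δ =>
    ofBranches (shrink gp (max δ 0)) (shrink gm (max δ 0))
  let Gd : ℝ → ℝ → ℝ → ℝ := fun δ =>
    ofBranches (average (shrink gp (max δ 0))) (average (shrink gm (max δ 0)))
  -- With `δ` clamped to `max δ 0`, the regularized coefficients depend continuously on all real
  -- `δ`, keep the common value of the branches at `0`, and for `δ = 0` are the original ones.
  have csh : ∀ {X : Type} [TopologicalSpace X] (h : ℝ → ℝ), Continuous h → ∀ d y : X → ℝ,
      Continuous d → Continuous y → Continuous fun z => shrink h (max (d z) 0) (y z) :=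
    fun h hh d y hd hy => (continuous_shrink hh).comp ((hd.max continuous_const).prodMk hy)
  have cgd : ∀ {X : Type} [TopologicalSpace X] (d a b : X → ℝ), Continuous d → Continuous a →
      Continuous b → Continuous fun z => gd (d z) (a z) (b z) := fun d a b hd ha hb =>
    continuous_ofBranches_comp (hp := fun z => shrink gp (max (d z) 0))
      (hm := fun z => shrink gm (max (d z) 0)) ha hb
      (csh gp hgp _ _ hd (by fun_prop)) (csh gm hgm _ _ hd (by fun_prop)) fun z => by
        rw [shrink_apply_zero _ (le_max_right _ _), shrink_apply_zero _ (le_max_right _ _), hg0]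
  have cav : ∀ h : ℝ → ℝ, Continuous h → Continuous fun z : ℝ × ℝ =>
      average (shrink h (max z.1 0)) z.2 := fun h hh =>
    continuous_average_comp (g := fun z : ℝ × ℝ => shrink h (max z.1 0))
      (csh h hh _ _ (by fun_prop) (by fun_prop)) continuous_snd
  have cGd : ∀ {X : Type} [TopologicalSpace X] (d a b : X → ℝ), Continuous d → Continuous a →
      Continuous b → Continuous fun z => Gd (d z) (a z) (b z) := fun d a b hd ha hb =>
    continuous_ofBranches_comp (hp := fun z => average (shrink gp (max (d z) 0)))
      (hm := fun z => average (shrink gm (max (d z) 0))) ha hb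
      ((cav gp hgp).comp (hd.prodMk (by fun_prop))) ((cav gm hgm).comp (hd.prodMk (by fun_prop)))
      fun z => by
        rw [average_zero, average_zero, shrink_apply_zero _ (le_max_right _ _),
          shrink_apply_zero _ (le_max_right _ _), hg0]
  let lhs : ℝ → ℝ := fun δ => ∫ x in a..b, (lag F (Gd δ) (u x + ε * φ x) (deriv u x + ε * deriv φ x)
        (deriv (deriv u) x + ε * deriv (deriv φ) x)
        - lag F (Gd δ) (u x) (deriv u x) (deriv (deriv u) x))
  let rhs : ℝ → ℝ := fun δ => ∫ s in (0 : ℝ)..ε,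
        ((∫ x in a..b, varDeriv f (gd δ) F (u x + s * φ x) (deriv u x + s * deriv φ x)
          (deriv (deriv u) x + s * deriv (deriv φ) x) * φ x)
        + (bdry F (Gd δ) (u b + s * φ b) (deriv u b + s * deriv φ b) (φ b) (deriv φ b)
          - bdry F (Gd δ) (u a + s * φ a) (deriv u a + s * deriv φ a) (φ a) (deriv φ a)))
  have clhs : Continuous lhs := by
    refine intervalIntegral.continuous_parametric_intervalIntegral_of_continuous' ?_ _ _
    have c1 := continuous_uncurry_comp cF (X := ℝ × ℝ) (a := fun z => u z.2 + ε * φ z.2)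
      (b := fun z => deriv u z.2 + ε * deriv φ z.2) (by fun_prop) (by fun_prop)
    have c2 := continuous_uncurry_comp cF (X := ℝ × ℝ) (a := fun z => u z.2)
      (b := fun z => deriv u z.2) (by fun_prop) (by fun_prop)
    have c3 := cGd (X := ℝ × ℝ) (fun z => z.1) (fun z => u z.2 + ε * φ z.2)
      (fun z => deriv u z.2 + ε * deriv φ z.2) (by fun_prop) (by fun_prop) (by fun_prop)
    have c4 := cGd (X := ℝ × ℝ) (fun z => z.1) (fun z => u z.2)
      (fun z => deriv u z.2) (by fun_prop) (by fun_prop) (by fun_prop)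
    simp only [lag, Function.uncurry_def]
    fun_prop
  have crhs : Continuous rhs := by
    refine intervalIntegral.continuous_parametric_intervalIntegral_of_continuous' ?_ _ _
    have cb : ∀ e : ℝ, Continuous fun z : ℝ × ℝ => bdry F (Gd z.1) (u e + z.2 * φ e)
        (deriv u e + z.2 * deriv φ e) (φ e) (deriv φ e) := by
      intro e
      have c1 := continuous_uncurry_comp cF (X := ℝ × ℝ) (a := fun z => u e + z.2 * φ e)
        (b := fun z => deriv u e + z.2 * deriv φ e) (by fun_prop) (by fun_prop)
      have c2 := cGd (X := ℝ × ℝ) (fun z => z.1) (fun z => u e + z.2 * φ e)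
        (fun z => deriv u e + z.2 * deriv φ e) (by fun_prop) (by fun_prop) (by fun_prop)
      simp only [bdry]
      fun_prop
    refine Continuous.add ?_ ((cb b).sub (cb a))
    refine intervalIntegral.continuous_parametric_intervalIntegral_of_continuous'
      (f := fun (z : ℝ × ℝ) x => varDeriv f (gd z.1) F (u x + z.2 * φ x)
        (deriv u x + z.2 * deriv φ x) (deriv (deriv u) x + z.2 * deriv (deriv φ) x) * φ x) ?_ _ _
    have c1 := continuous_uncurry_comp cF (X := (ℝ × ℝ) × ℝ)
      (a := fun z => u z.2 + z.1.2 * φ z.2)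
      (b := fun z => deriv u z.2 + z.1.2 * deriv φ z.2) (by fun_prop) (by fun_prop)
    have c2 := continuous_uncurry_comp cf (X := (ℝ × ℝ) × ℝ)
      (a := fun z => u z.2 + z.1.2 * φ z.2)
      (b := fun z => deriv u z.2 + z.1.2 * deriv φ z.2) (by fun_prop) (by fun_prop)
    have c3 := cgd (X := (ℝ × ℝ) × ℝ) (fun z => z.1.1) (fun z => u z.2 + z.1.2 * φ z.2)
      (fun z => deriv u z.2 + z.1.2 * deriv φ z.2) (by fun_prop) (by fun_prop) (by fun_prop)
    simp only [varDeriv, Function.uncurry_def]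
    fun_prop
  have heq : ∀ δ, 0 < δ → lhs δ = rhs δ := by
    intro δ hδ
    have hm : max δ 0 = δ := max_eq_left hδ.le
    have hFf : HasInvariantDeriv F f := hasInvariantDeriv_ofBranches (hasDerivAt_primitive hfp)
      (hasDerivAt_primitive hfm) (by rw [primitive_zero, primitive_zero]) hf0
    have cG : Continuous (Function.uncurry (Gd δ)) :=
      cGd (X := ℝ × ℝ) (fun _ => δ) _ _ continuous_const continuous_fst continuous_snd
    refine integral_lag_sub_of_hasInvariantDeriv (g := gd δ)
      (k := ofBranches (fun y => (shrink gp δ y - average (shrink gp δ) y) / y)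
        (fun y => (shrink gm δ y - average (shrink gm δ) y) / y)) cf cF cG
      (continuous_ofBranches (continuous_deriv_average_shrink hgp hδ)
        (continuous_deriv_average_shrink hgm hδ) (by simp)) hFf ?_ ?_ hu hφ a b ε
    · simp only [Gd, hm]
      refine hasInvariantDeriv_ofBranches (hasDerivAt_average_shrink hgp hδ)
        (hasDerivAt_average_shrink hgm hδ) ?_ (by simp)
      rw [average_zero, average_zero, shrink_apply_zero _ hδ.le, shrink_apply_zero _ hδ.le, hg0]
    · intro u v
      have key : ∀ (h : ℝ → ℝ) (y : ℝ), y * ((shrink h δ y - average (shrink h δ) y) / y)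
          + average (shrink h δ) y = shrink h δ y := by
        intro h y
        rcases eq_or_ne y 0 with rfl | hy
        · rw [average_zero]; ring
        · field_simp; ring
      simp only [Gd, gd, hm, ofBranches]
      split_ifs <;> exact key _ _
  -- Both sides are continuous in `δ` and agree for `δ > 0`, hence also in the limit.
  have h0 : lhs 0 = rhs 0 := by
    have t1 : Filter.Tendsto lhs (nhdsWithin 0 (Set.Ioi 0)) (nhds (lhs 0)) :=
      clhs.continuousAt.tendsto.mono_left nhdsWithin_le_nhds
    have t2 : Filter.Tendsto rhs (nhdsWithin 0 (Set.Ioi 0)) (nhds (rhs 0)) :=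
      crhs.continuousAt.tendsto.mono_left nhdsWithin_le_nhds
    refine tendsto_nhds_unique (t1.congr' ?_) t2
    filter_upwards [self_mem_nhdsWithin] with δ hδ using heq δ hδ
  have eg : gd 0 = g := by simp only [gd, max_self, shrink_zero, g]
  have eG : Gd 0 = G := by simp only [Gd, max_self, shrink_zero, G]
  simpa only [lhs, rhs, eg, eG] using h0

/-! ### The density along jets, and derivatives in ε -/

theorem deriv_add_const_mul {u φ : ℝ → ℝ} (hu : ContDiff ℝ ∞ u) (hφ : ContDiff ℝ ∞ φ) (ε : ℝ) :
    deriv (fun y => u y + ε * φ y) = fun x => deriv u x + ε * deriv φ x :=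
  funext fun x => ((smooth_hasDerivAt hu x).add ((smooth_hasDerivAt hφ x).const_mul ε)).deriv

theorem density_jet (F G : ℝ → ℝ → ℝ) (u : ℝ → ℝ) (x : ℝ) :
    density F G x (jet 2 u x) = lag F G (u x) (deriv u x) (deriv (deriv u) x) := by
  simp [density, jet, lag, iteratedDeriv_succ]

theorem density_jet_add {F G : ℝ → ℝ → ℝ} {u φ : ℝ → ℝ} (hu : ContDiff ℝ ∞ u)
    (hφ : ContDiff ℝ ∞ φ) (ε x : ℝ) :
    density F G x (jet 2 (fun y => u y + ε * φ y) x)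
      = lag F G (u x + ε * φ x) (deriv u x + ε * deriv φ x)
        (deriv (deriv u) x + ε * deriv (deriv φ) x) := by
  rw [density_jet, deriv_add_const_mul hu hφ,
    deriv_add_const_mul (smooth_deriv hu) (smooth_deriv hφ)]

theorem continuous_varDeriv {f g F : ℝ → ℝ → ℝ} (hf : Continuous (Function.uncurry f))
    (hg : Continuous (Function.uncurry g)) (hF : Continuous (Function.uncurry F)) :
    Continuous fun z : ℝ × ℝ × ℝ => varDeriv f g F z.1 z.2.1 z.2.2 := by
  have c1 := continuous_uncurry_comp hf (X := ℝ × ℝ × ℝ) (a := fun z => z.1)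
    (b := fun z => z.2.1) (by fun_prop) (by fun_prop)
  have c2 := continuous_uncurry_comp hg (X := ℝ × ℝ × ℝ) (a := fun z => z.1)
    (b := fun z => z.2.1) (by fun_prop) (by fun_prop)
  have c3 := continuous_uncurry_comp hF (X := ℝ × ℝ × ℝ) (a := fun z => z.1)
    (b := fun z => z.2.1) (by fun_prop) (by fun_prop)
  unfold varDeriv
  fun_prop

theorem continuous_varDeriv_comp {X : Type*} [TopologicalSpace X] {f g F : ℝ → ℝ → ℝ}
    (hf : Continuous (Function.uncurry f)) (hg : Continuous (Function.uncurry g))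
    (hF : Continuous (Function.uncurry F)) {a b c : X → ℝ} (ha : Continuous a) (hb : Continuous b)
    (hc : Continuous c) : Continuous fun z => varDeriv f g F (a z) (b z) (c z) :=
  (continuous_varDeriv hf hg hF).comp (ha.prodMk (hb.prodMk hc))

theorem hasDerivAt_of_sub_eq_integral {H J : ℝ → ℝ} (hJ : Continuous J)
    (h : ∀ ε, H ε - H 0 = ∫ s in (0 : ℝ)..ε, J s) : HasDerivAt H (J 0) 0 := by
  have := ((hJ.integral_hasStrictDerivAt 0 0).hasDerivAt).add_const (H 0)
  refine this.congr_of_eventuallyEq (Filter.Eventually.of_forall fun ε => ?_)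
  simp only [← h ε, sub_add_cancel]

/-! ### Solving Δψ = W -/

/-- A solution `ψ` of `Δ ψ = W` by variation of constants. -/
theorem exists_helm_eq_of_hasDerivAt {W I₁ I₂ : ℝ → ℝ} (hW : Continuous W)
    (h₁ : ∀ x, HasDerivAt I₁ (Real.exp x * W x) x)
    (h₂ : ∀ x, HasDerivAt I₂ (-(Real.exp (-x) * W x)) x) :
    ∃ ψ : ℝ → ℝ, ContDiff ℝ 2 ψ ∧ (∀ x, helm ψ x = W x) ∧
      (∀ x, ψ x = 1 / 2 * (Real.exp (-x) * I₁ x + Real.exp x * I₂ x)) ∧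
      (∀ x, deriv ψ x = 1 / 2 * (Real.exp x * I₂ x - Real.exp (-x) * I₁ x)) := by
  have he : ∀ x : ℝ, HasDerivAt (fun x => Real.exp (-x)) (-Real.exp (-x)) x := fun x => by
    simpa using (hasDerivAt_neg x).exp
  have hee : ∀ x : ℝ, Real.exp (-x) * Real.exp x = 1 := fun x => by
    rw [← Real.exp_add, neg_add_cancel, Real.exp_zero]
  have d1 : ∀ x, HasDerivAt (fun x => 1 / 2 * (Real.exp (-x) * I₁ x + Real.exp x * I₂ x))
      (1 / 2 * (Real.exp x * I₂ x - Real.exp (-x) * I₁ x)) x := fun x => by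
    refine ((((he x).mul (h₁ x)).add ((Real.hasDerivAt_exp x).mul (h₂ x))).const_mul
      (1 / 2)).congr_deriv ?_
    ring
  have d2 : ∀ x, HasDerivAt (fun x => 1 / 2 * (Real.exp x * I₂ x - Real.exp (-x) * I₁ x))
      (1 / 2 * (Real.exp (-x) * I₁ x + Real.exp x * I₂ x) - W x) x := fun x => by
    refine ((((Real.hasDerivAt_exp x).mul (h₂ x)).sub ((he x).mul (h₁ x))).const_mul
      (1 / 2)).congr_deriv ?_
    linear_combination (-W x) * hee x
  have e1 := funext fun x => (d1 x).deriv
  have e2 := funext fun x => (d2 x).deriv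
  have c1 : Continuous fun x => 1 / 2 * (Real.exp (-x) * I₁ x + Real.exp x * I₂ x) :=
    continuous_iff_continuousAt.2 fun x => (d1 x).continuousAt
  refine ⟨_, ?_, fun x => ?_, fun _ => rfl, fun x => (d1 x).deriv⟩
  · refine (contDiff_succ_iff_deriv (n := 1)).2 ⟨fun x => (d1 x).differentiableAt, by simp, ?_⟩
    rw [e1]
    refine (contDiff_succ_iff_deriv (n := 0)).2 ⟨fun x => (d2 x).differentiableAt, by simp, ?_⟩
    rw [e2]
    exact contDiff_zero.2 (c1.sub hW)
  · rw [helm_eq, e1, e2]; ring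

theorem exists_helm_eq {W : ℝ → ℝ} (hW : Continuous W) :
    ∃ ψ : ℝ → ℝ, ContDiff ℝ 2 ψ ∧ ∀ x, helm ψ x = W x := by
  have c1 : Continuous fun x => Real.exp x * W x := Real.continuous_exp.mul hW
  have c2 : Continuous fun x => -(Real.exp (-x) * W x) :=
    ((Real.continuous_exp.comp continuous_neg).mul hW).neg
  obtain ⟨ψ, h1, h2, -⟩ := exists_helm_eq_of_hasDerivAt hW
    (fun x => (c1.integral_hasStrictDerivAt 0 x).hasDerivAt)
    (fun x => (c2.integral_hasStrictDerivAt 0 x).hasDerivAt)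
  exact ⟨ψ, h1, h2⟩

theorem exists_bounded_antideriv_exp_mul {W : ℝ → ℝ} (hW : Continuous W) {C : ℝ}
    (hC : ∀ x, |W x| ≤ C) :
    ∃ I : ℝ → ℝ, (∀ x, HasDerivAt I (Real.exp x * W x) x) ∧ ∀ x, |I x| ≤ C * Real.exp x := by
  have c1 : Continuous fun x => Real.exp x * W x := Real.continuous_exp.mul hW
  have hi : ∀ x, IntegrableOn (fun x => Real.exp x * W x) (Set.Iic x) := fun x =>
    Integrable.mul_bdd (c := C) (integrableOn_exp_Iic x) hW.aestronglyMeasurable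
      (Filter.Eventually.of_forall hC)
  refine ⟨fun x => ∫ t in Set.Iic x, Real.exp t * W t, fun x => ?_, fun x => ?_⟩
  · have := ((c1.integral_hasStrictDerivAt 0 x).hasDerivAt).add_const
      (∫ t in Set.Iic (0 : ℝ), Real.exp t * W t)
    refine this.congr_of_eventuallyEq (Filter.Eventually.of_forall fun z => ?_)
    simp only
    rw [← intervalIntegral.integral_Iic_sub_Iic (hi 0) (hi z), sub_add_cancel]
  · calc |∫ t in Set.Iic x, Real.exp t * W t| ≤ ∫ t in Set.Iic x, C * Real.exp t := by
          rw [← Real.norm_eq_abs]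
          refine norm_integral_le_of_norm_le (Integrable.const_mul (integrableOn_exp_Iic x) C)
            (Filter.Eventually.of_forall fun t => ?_)
          rw [Real.norm_eq_abs, abs_mul, abs_of_pos (Real.exp_pos t), mul_comm]
          exact mul_le_mul_of_nonneg_right (hC t) (Real.exp_pos t).le
      _ = C * Real.exp x := by rw [integral_const_mul, integral_exp_Iic]

/-- The bounded solution is the convolution of `W` with `½ e^{-|x|}`. Each of its two one-sided
pieces contributes at most `C / 2` to `ψ` and to `ψ'`. The piece on the right is the one on the left
for the reflected function. -/
theorem exists_bounded_helm_eq {W : ℝ → ℝ} (hW : Continuous W) {C : ℝ} (hC : ∀ x, |W x| ≤ C) :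
    ∃ ψ : ℝ → ℝ, ContDiff ℝ 2 ψ ∧ (∀ x, helm ψ x = W x) ∧ (∀ x, |ψ x| ≤ C) ∧
      ∀ x, |deriv ψ x| ≤ C := by
  obtain ⟨I₁, h1, b1⟩ := exists_bounded_antideriv_exp_mul hW hC
  obtain ⟨I₂, h2, b2⟩ := exists_bounded_antideriv_exp_mul (hW.comp continuous_neg)
    (C := C) (fun x => hC (-x))
  have h2' : ∀ x, HasDerivAt (fun x => I₂ (-x)) (-(Real.exp (-x) * W x)) x := fun x => by
    simpa [Function.comp_def] using (h2 (-x)).comp x (hasDerivAt_neg x)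
  obtain ⟨ψ, hψ, hh, e0, e1⟩ := exists_helm_eq_of_hasDerivAt hW h1 h2'
  have hee : ∀ x : ℝ, Real.exp (-x) * Real.exp x = 1 := fun x => by
    rw [← Real.exp_add, neg_add_cancel, Real.exp_zero]
  have k1 : ∀ x, |Real.exp (-x) * I₁ x| ≤ C := fun x => by
    rw [abs_mul, abs_of_pos (Real.exp_pos _)]
    calc _ ≤ Real.exp (-x) * (C * Real.exp x) :=
          mul_le_mul_of_nonneg_left (b1 x) (Real.exp_pos _).le
      _ = C := by linear_combination C * hee x
  have k2 : ∀ x, |Real.exp x * I₂ (-x)| ≤ C := fun x => by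
    rw [abs_mul, abs_of_pos (Real.exp_pos _)]
    calc _ ≤ Real.exp x * (C * Real.exp (-x)) :=
          mul_le_mul_of_nonneg_left (b2 (-x)) (Real.exp_pos _).le
      _ = C := by linear_combination C * hee x
  refine ⟨ψ, hψ, hh, fun x => ?_, fun x => ?_⟩
  · have a1 := abs_le.1 (k1 x)
    have a2 := abs_le.1 (k2 x)
    rw [e0, abs_le]; constructor <;> linarith
  · have a1 := abs_le.1 (k1 x)
    have a2 := abs_le.1 (k2 x)
    rw [e1, abs_le]; constructor <;> linarith

/-! ### Sufficiency for arbitrary smooth u -/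

theorem exists_bound_on_box {K : ℝ × ℝ × ℝ → ℝ} (hK : Continuous K) (R : ℝ) :
    ∃ C, 0 ≤ C ∧ ∀ a b c, |a| ≤ R → |b| ≤ R → |c| ≤ R → |K (a, b, c)| ≤ C := by
  have hc : IsCompact (Set.Icc (-R) R ×ˢ (Set.Icc (-R) R ×ˢ Set.Icc (-R) R)) :=
    isCompact_Icc.prod (isCompact_Icc.prod isCompact_Icc)
  obtain ⟨C, hC⟩ := hc.exists_bound_of_continuousOn hK.continuousOn
  refine ⟨max C 0, le_max_right _ _, fun a b c ha hb hc => ?_⟩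
  exact (hC (a, b, c) ⟨abs_le.1 ha, abs_le.1 hb, abs_le.1 hc⟩).trans (le_max_left _ _)

theorem continuous_ofBranches_primitive {fp fm : ℝ → ℝ} (hfp : Continuous fp)
    (hfm : Continuous fm) :
    Continuous (Function.uncurry (ofBranches (primitive fp) (primitive fm))) :=
  continuous_ofBranches (continuous_primitive hfp) (continuous_primitive hfm)
    (by rw [primitive_zero, primitive_zero])

theorem continuous_ofBranches_average {gp gm : ℝ → ℝ} (hgp : Continuous gp) (hgm : Continuous gm)
    (hg0 : gp 0 = gm 0) :
    Continuous (Function.uncurry (ofBranches (average gp) (average gm))) :=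
  continuous_ofBranches (continuous_average hgp) (continuous_average hgm)
    (by rw [average_zero, average_zero, hg0])

/-- The basic identity `D_x(u² - u_x²) = 2 u_x m`, which makes `u_x f₁ m` an exact `x`-derivative.
-/
theorem hasDerivAt_ofBranches_primitive {fp fm : ℝ → ℝ} (hfp : Continuous fp)
    (hfm : Continuous fm) (hf0 : fp 0 = fm 0) {u : ℝ → ℝ} (hu : ContDiff ℝ ∞ u) (x : ℝ) :
    HasDerivAt (fun x => 1 / 2 * ofBranches (primitive fp) (primitive fm) (u x) (deriv u x))
      (deriv u x * ofBranches fp fm (u x) (deriv u x) * helm u x) x := by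
  refine ((hasInvariantDeriv_ofBranches (hasDerivAt_primitive hfp) (hasDerivAt_primitive hfm)
    (by rw [primitive_zero, primitive_zero]) hf0 _ _ _ _ x (smooth_hasDerivAt hu x)
    (smooth_hasDerivAt (smooth_deriv hu) x)).const_mul (1 / 2)).congr_deriv ?_
  rw [helm_eq]; ring

theorem hasDerivAt_integral_density {fp fm gp gm : ℝ → ℝ} (hfp : Continuous fp)
    (hfm : Continuous fm) (hgp : Continuous gp) (hgm : Continuous gm) (hf0 : fp 0 = fm 0)
    (hg0 : gp 0 = gm 0) {u φ : ℝ → ℝ} (hu : ContDiff ℝ ∞ u) (hφ : IsTest φ) :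
    HasDerivAt (fun ε : ℝ => ∫ x,
      (density (ofBranches (primitive fp) (primitive fm)) (ofBranches (average gp) (average gm)) x
          (jet 2 (fun y => u y + ε * φ y) x)
        - density (ofBranches (primitive fp) (primitive fm))
          (ofBranches (average gp) (average gm)) x (jet 2 u x)))
      (∫ x, varDeriv (ofBranches fp fm) (ofBranches gp gm)
        (ofBranches (primitive fp) (primitive fm)) (u x) (deriv u x) (deriv (deriv u) x) * φ x) 0 := by
  have cf := continuous_ofBranches hfp hfm hf0
  have cg := continuous_ofBranches hgp hgm hg0
  have cF := continuous_ofBranches_primitive hfp hfm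
  set F := ofBranches (primitive fp) (primitive fm)
  set G := ofBranches (average gp) (average gm)
  obtain ⟨R, hR, hs⟩ := hφ.exists_bound
  have hz : ∀ x, x ∉ Set.Ioo (-R) R → φ x = 0 ∧ deriv φ x = 0 ∧ helm φ x = 0 := fun x hx =>
    eq_zero_of_notMem_tsupport (hs x hx)
  have hz2 : ∀ x, x ∉ Set.Ioo (-R) R → deriv (deriv φ) x = 0 := fun x hx => by
    obtain ⟨h1, -, h3⟩ := hz x hx
    rw [helm_eq, h1] at h3; linarith
  let J : ℝ → ℝ := fun s => ∫ x in (-R)..R, varDeriv (ofBranches fp fm) (ofBranches gp gm) F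
    (u x + s * φ x) (deriv u x + s * deriv φ x) (deriv (deriv u) x + s * deriv (deriv φ) x) * φ x
  have cu := hu.continuous
  have cu' := (smooth_deriv hu).continuous
  have cu'' := (smooth_deriv (smooth_deriv hu)).continuous
  have cφ := hφ.1.continuous
  have cφ' := (smooth_deriv hφ.1).continuous
  have cφ'' := (smooth_deriv (smooth_deriv hφ.1)).continuous
  have hJ : Continuous J := by
    refine intervalIntegral.continuous_parametric_intervalIntegral_of_continuous' ?_ _ _
    exact (continuous_varDeriv_comp (X := ℝ × ℝ) cf cg cF (a := fun z => u z.2 + z.1 * φ z.2)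
      (b := fun z => deriv u z.2 + z.1 * deriv φ z.2)
      (c := fun z => deriv (deriv u) z.2 + z.1 * deriv (deriv φ) z.2)
      (by fun_prop) (by fun_prop) (by fun_prop)).mul (cφ.comp continuous_snd)
  have hJ0 : J 0 = ∫ x, varDeriv (ofBranches fp fm) (ofBranches gp gm) F (u x) (deriv u x)
      (deriv (deriv u) x) * φ x := by
    rw [integral_eq_intervalIntegral hR fun x hx => by rw [(hz x hx).1, mul_zero]]
    simp [J]
  rw [← hJ0]
  refine hasDerivAt_of_sub_eq_integral hJ fun ε => ?_
  simp only [density_jet_add hu hφ.1, density_jet]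
  have e0 : ∫ x, (lag F G (u x + 0 * φ x) (deriv u x + 0 * deriv φ x)
      (deriv (deriv u) x + 0 * deriv (deriv φ) x) - lag F G (u x) (deriv u x) (deriv (deriv u) x))
      = 0 := by simp
  rw [e0, sub_zero, integral_eq_intervalIntegral hR fun x hx => by simp [hz x hx, hz2 x hx],
    integral_lag_sub hfp hfm hgp hgm hf0 hg0 hu hφ.1]
  refine intervalIntegral.integral_congr fun s _ => ?_
  -- The endpoints `±R` lie outside the open interval containing the support, so `φ` and `φ'` vanish
  -- there and the boundary terms drop out.
  have n1 : R ∉ Set.Ioo (-R) R := by simp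
  have n2 : -R ∉ Set.Ioo (-R) R := by simp
  simp only [J, bdry, hz _ n1, hz _ n2]
  simp [F]

/-- Here `Δψ = (u f₁ + g) m + ½ F₁`. The first summand is the flux of the equation and the second
has `x`-derivative `u_x f₁ m`; only `F₁` has to be differentiated, so the weak form needs no
smoothness of `f₁` or `g`. -/
theorem flowEq_of_helm_eq {fp fm : ℝ → ℝ} (hfp : Continuous fp) (hfm : Continuous fm)
    (hf0 : fp 0 = fm 0) {g : ℝ → ℝ → ℝ} (hg : Continuous (Function.uncurry g))
    {u ψ : ℝ → ℝ} (hu : ContDiff ℝ ∞ u)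
    (hψ : ∀ x, helm ψ x = varDeriv (ofBranches fp fm) g
      (ofBranches (primitive fp) (primitive fm)) (u x) (deriv u x) (deriv (deriv u) x)) :
    FlowEq (fun u v => v * ofBranches fp fm u v) (fun u v => u * ofBranches fp fm u v + g u v)
      u ψ := by
  intro χ hχ
  have cu := hu.continuous
  have cu' := (smooth_deriv hu).continuous
  have cm := continuous_helm hu
  have cχ := hχ.1.continuous
  have cχ' := (smooth_deriv hχ.1).continuous
  have c1 := continuous_uncurry_comp (continuous_ofBranches hfp hfm hf0) cu cu'
  have c2 := continuous_uncurry_comp hg cu cu'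
  have c3 := continuous_uncurry_comp (continuous_ofBranches_primitive hfp hfm) cu cu'
  set F := ofBranches (primitive fp) (primitive fm) with hF
  have ck : Continuous fun x => deriv u x * ofBranches fp fm (u x) (deriv u x) * helm u x * χ x
      + 1 / 2 * F (u x) (deriv u x) * deriv χ x :=
    (((cu'.mul c1).mul cm).mul cχ).add ((continuous_const.mul c3).mul cχ')
  have key : ∫ x, (deriv u x * ofBranches fp fm (u x) (deriv u x) * helm u x * χ x
      + 1 / 2 * F (u x) (deriv u x) * deriv χ x) = 0 := by
    refine integral_eq_zero_of_hasCompactSupport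
      (fun x => (hasDerivAt_ofBranches_primitive hfp hfm hf0 hu x).mul (smooth_hasDerivAt hχ.1 x))
      ck hχ.2.mul_left
  have i1 : Integrable fun x => deriv u x * ofBranches fp fm (u x) (deriv u x) * helm u x * χ x
      + 1 / 2 * F (u x) (deriv u x) * deriv χ x :=
    ck.integrable_of_hasCompactSupport
      (hχ.2.mul_left.add hχ.deriv.2.mul_left)
  have i2 : Integrable fun x => helm ψ x * deriv χ x := by
    refine Continuous.integrable_of_hasCompactSupport ?_ hχ.deriv.2.mul_left
    simp only [hψ]
    exact (continuous_varDeriv_comp (continuous_ofBranches hfp hfm hf0) hg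
      (continuous_ofBranches_primitive hfp hfm) cu cu'
      (smooth_deriv (smooth_deriv hu)).continuous).mul cχ'
  have : ∀ x, deriv u x * ofBranches fp fm (u x) (deriv u x) * helm u x * χ x
      - (u x * ofBranches fp fm (u x) (deriv u x) + g (u x) (deriv u x)) * helm u x * deriv χ x
      = (deriv u x * ofBranches fp fm (u x) (deriv u x) * helm u x * χ x
      + 1 / 2 * F (u x) (deriv u x) * deriv χ x) - helm ψ x * deriv χ x := by
    intro x
    rw [hψ, helm_eq, varDeriv]; ring
  simp only [this]
  rw [integral_sub i1 i2, key, zero_sub]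

/-- Since `Δ` is symmetric, `∫ ψ Δφ` is the first variation `∫ W φ` for any solution of `Δψ = W`;
its growth is irrelevant against compactly supported variations. -/
theorem isHamiltonianDensity_ofBranches {fp fm gp gm : ℝ → ℝ} (hfp : Continuous fp)
    (hfm : Continuous fm) (hgp : Continuous gp) (hgm : Continuous gm) (hf0 : fp 0 = fm 0)
    (hg0 : gp 0 = gm 0) :
    IsHamiltonianDensity
      (fun u v => v * ofBranches fp fm u v)
      (fun u v => u * ofBranches fp fm u v + ofBranches gp gm u v)
      (density (ofBranches (primitive fp) (primitive fm))
        (ofBranches (average gp) (average gm))) := by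
  have cf := continuous_ofBranches hfp hfm hf0
  have cg := continuous_ofBranches hgp hgm hg0
  have cF := continuous_ofBranches_primitive hfp hfm
  refine ⟨?_, fun u hu => ?_⟩
  · have c1 := continuous_uncurry_comp cF (X := ℝ × (Fin (2 + 1) → ℝ)) (a := fun z => z.2 0)
      (b := fun z => z.2 1) (by fun_prop) (by fun_prop)
    have c2 := continuous_uncurry_comp (continuous_ofBranches_average hgp hgm hg0)
      (X := ℝ × (Fin (2 + 1) → ℝ)) (a := fun z => z.2 0)
      (b := fun z => z.2 1) (by fun_prop) (by fun_prop)
    simp only [density, Function.uncurry_def]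
    fun_prop
  · have cW := continuous_varDeriv_comp cf cg cF hu.continuous (smooth_deriv hu).continuous
      (smooth_deriv (smooth_deriv hu)).continuous
    obtain ⟨ψ, h1, h2⟩ := exists_helm_eq cW
    refine ⟨ψ, h1, fun φ hφ => ?_, flowEq_of_helm_eq hfp hfm hf0 cg hu h2⟩
    rw [integral_mul_helm h1 hφ]
    simp only [h2]
    exact hasDerivAt_integral_density hfp hfm hgp hgm hf0 hg0 hu hφ

/-! ### Sufficiency on the Schwartz space -/

theorem schwartz_exists_abs_le (u : 𝓢(ℝ, ℝ)) : ∃ C, 0 ≤ C ∧ ∀ x, |u x| ≤ C :=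
  ⟨_, apply_nonneg _ _, fun x => SchwartzMap.norm_le_seminorm ℝ u x⟩

theorem schwartz_exists_deriv (u : 𝓢(ℝ, ℝ)) : ∃ u' : 𝓢(ℝ, ℝ), deriv u = u' :=
  ⟨SchwartzMap.derivCLM ℝ ℝ u, funext fun x => (SchwartzMap.derivCLM_apply ℝ u x).symm⟩

theorem schwartz_tendsto_zero (u : 𝓢(ℝ, ℝ)) :
    Filter.Tendsto u Filter.atTop (nhds 0) ∧ Filter.Tendsto u Filter.atBot (nhds 0) :=
  ⟨u.tendsto_cocompact.mono_left (by rw [cocompact_eq_atBot_atTop]; exact le_sup_right),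
    u.tendsto_cocompact.mono_left (by rw [cocompact_eq_atBot_atTop]; exact le_sup_left)⟩

theorem integrable_bdd_mul_schwartz {k : ℝ → ℝ} (hk : Continuous k) {C : ℝ} (hC : ∀ x, |k x| ≤ C)
    (φ : 𝓢(ℝ, ℝ)) : Integrable fun x => k x * φ x :=
  φ.integrable.bdd_mul hk.aestronglyMeasurable (Filter.Eventually.of_forall hC)

/-- The boundary expression `ψ φ' - ψ' φ` is integrable when `ψ` and `ψ'` are bounded, so the
integral of its derivative over the line vanishes. -/
theorem integral_mul_helm_schwartz {ψ : ℝ → ℝ} (hψ : ContDiff ℝ 2 ψ) {C C' : ℝ}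
    (h0 : ∀ x, |ψ x| ≤ C) (h1 : ∀ x, |deriv ψ x| ≤ C) (h2 : ∀ x, |helm ψ x| ≤ C')
    (φ : 𝓢(ℝ, ℝ)) : ∫ x, ψ x * helm φ x = ∫ x, helm ψ x * φ x := by
  obtain ⟨φ', e1⟩ := schwartz_exists_deriv φ
  obtain ⟨φ'', e2⟩ := schwartz_exists_deriv φ'
  have hφ : ContDiff ℝ ∞ φ := φ.smooth _
  have hψ1 : ∀ x, HasDerivAt ψ (deriv ψ x) x := fun x =>
    (hψ.differentiable (by norm_num) x).hasDerivAt
  have hψ2' : ContDiff ℝ 1 (deriv ψ) := ((contDiff_succ_iff_deriv (n := 1)).1 hψ).2.2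
  have hψ2 : ∀ x, HasDerivAt (deriv ψ) (deriv (deriv ψ) x) x := fun x =>
    (hψ2'.differentiable (by norm_num) x).hasDerivAt
  have i1 : Integrable fun x => helm ψ x * φ x :=
    integrable_bdd_mul_schwartz (continuous_helm_of_contDiff_two hψ) h2 φ
  have i2 : Integrable fun x => ψ x * helm φ x := by
    have : (fun x => ψ x * helm φ x) = fun x => ψ x * φ x - ψ x * φ'' x := by
      funext x; rw [helm_eq, e1, e2]; ring
    rw [this]
    exact (integrable_bdd_mul_schwartz hψ.continuous h0 φ).sub
      (integrable_bdd_mul_schwartz hψ.continuous h0 φ'')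
  have key : ∫ x, (helm ψ x * φ x - ψ x * helm φ x) = 0 := by
    refine integral_eq_zero_of_hasDerivAt_of_integrable
      (f := fun x => ψ x * deriv φ x - deriv ψ x * φ x) (fun x => ?_) (i1.sub i2) ?_
    · refine (((hψ1 x).mul (smooth_hasDerivAt (smooth_deriv hφ) x)).sub
        ((hψ2 x).mul (smooth_hasDerivAt hφ x))).congr_deriv ?_
      rw [helm_eq, helm_eq]; ring
    · rw [e1]
      exact (integrable_bdd_mul_schwartz hψ.continuous h0 φ').sub
        (integrable_bdd_mul_schwartz hψ2'.continuous h1 φ)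
  rw [integral_sub i1 i2] at key
  linarith

theorem continuous_box_coeff {F G : ℝ → ℝ → ℝ} (hF : Continuous (Function.uncurry F))
    (hG : Continuous (Function.uncurry G)) :
    Continuous (fun z : ℝ × ℝ × ℝ => 1 / 2 * (F z.1 z.2.1 + z.1 * G z.1 z.2.1)) ∧
      Continuous fun z : ℝ × ℝ × ℝ => 1 / 2 * z.2.1 * G z.1 z.2.1 := by
  have c1 := continuous_uncurry_comp hF (X := ℝ × ℝ × ℝ) (a := fun z => z.1)
    (b := fun z => z.2.1) (by fun_prop) (by fun_prop)
  have c2 := continuous_uncurry_comp hG (X := ℝ × ℝ × ℝ) (a := fun z => z.1)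
    (b := fun z => z.2.1) (by fun_prop) (by fun_prop)
  constructor <;> fun_prop

theorem integrable_lag_schwartz {F G : ℝ → ℝ → ℝ} (hF : Continuous (Function.uncurry F))
    (hG : Continuous (Function.uncurry G)) (u u' u'' : 𝓢(ℝ, ℝ)) :
    Integrable fun x => lag F G (u x) (u' x) (u'' x) := by
  obtain ⟨K, hK, bu⟩ := schwartz_exists_abs_le u
  obtain ⟨K', hK', bu'⟩ := schwartz_exists_abs_le u'
  obtain ⟨C, -, hC⟩ := exists_bound_on_box (continuous_box_coeff hF hG).1 (max K K')
  have hc : Continuous fun x => 1 / 2 * (F (u x) (u' x) + u x * G (u x) (u' x)) :=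
    (continuous_box_coeff hF hG).1.comp
      (u.continuous.prodMk (u'.continuous.prodMk u.continuous))
  exact integrable_bdd_mul_schwartz hc
    (fun x => hC (u x) (u' x) (u x) ((bu x).trans (le_max_left _ _))
      ((bu' x).trans (le_max_right _ _)) ((bu x).trans (le_max_left _ _))) (u - u'')

/-- The first variation of `∫ ½ (F + u G) m` on the Schwartz space, in integrated form. -/
theorem hasDerivAt_functional_schwartz {fp fm gp gm : ℝ → ℝ} (hfp : Continuous fp)
    (hfm : Continuous fm) (hgp : Continuous gp) (hgm : Continuous gm) (hf0 : fp 0 = fm 0)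
    (hg0 : gp 0 = gm 0) (u φ : 𝓢(ℝ, ℝ)) :
    HasDerivAt (fun ε : ℝ => functional
      (density (ofBranches (primitive fp) (primitive fm)) (ofBranches (average gp) (average gm)))
        (fun y => u y + ε * φ y))
      (∫ x, varDeriv (ofBranches fp fm) (ofBranches gp gm)
        (ofBranches (primitive fp) (primitive fm)) (u x) (deriv u x) (deriv (deriv u) x) * φ x) 0 := by
  have cf := continuous_ofBranches hfp hfm hf0
  have cg := continuous_ofBranches hgp hgm hg0
  have cF := continuous_ofBranches_primitive hfp hfm
  have cG := continuous_ofBranches_average hgp hgm hg0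
  have rect := fun a b ε => integral_lag_sub hfp hfm hgp hgm hf0 hg0 (u.smooth ⊤) (φ.smooth ⊤) a b ε
  simp only [functional, density_jet_add (u.smooth ⊤) (φ.smooth ⊤)]
  obtain ⟨u', eu1⟩ := schwartz_exists_deriv u
  obtain ⟨u'', eu2⟩ := schwartz_exists_deriv u'
  obtain ⟨φ', eφ1⟩ := schwartz_exists_deriv φ
  obtain ⟨φ'', eφ2⟩ := schwartz_exists_deriv φ'
  simp only [eu1, eu2, eφ1, eφ2] at rect ⊢
  set F := ofBranches (primitive fp) (primitive fm)
  set G := ofBranches (average gp) (average gm)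
  set f := ofBranches fp fm
  set g := ofBranches gp gm
  obtain ⟨K0, hK0, bu⟩ := schwartz_exists_abs_le u
  obtain ⟨K1, hK1, bu'⟩ := schwartz_exists_abs_le u'
  obtain ⟨K2, hK2, bu''⟩ := schwartz_exists_abs_le u''
  obtain ⟨K3, hK3, bφ⟩ := schwartz_exists_abs_le φ
  obtain ⟨K4, hK4, bφ'⟩ := schwartz_exists_abs_le φ'
  obtain ⟨K5, hK5, bφ''⟩ := schwartz_exists_abs_le φ''
  have cu := u.continuous
  have cu' := u'.continuous
  have cu'' := u''.continuous
  have cφ := φ.continuous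
  have cφ' := φ'.continuous
  have cφ'' := φ''.continuous
  let W : ℝ → ℝ → ℝ := fun s x =>
    varDeriv f g F (u x + s * φ x) (u' x + s * φ' x) (u'' x + s * φ'' x)
  have cW : Continuous fun z : ℝ × ℝ => W z.1 z.2 :=
    continuous_varDeriv_comp (X := ℝ × ℝ) cf cg cF (a := fun z => u z.2 + z.1 * φ z.2)
      (b := fun z => u' z.2 + z.1 * φ' z.2) (c := fun z => u'' z.2 + z.1 * φ'' z.2)
      (by fun_prop) (by fun_prop) (by fun_prop)
  let S := K0 + K1 + K2 + K3 + K4 + K5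
  -- the jets of `u + s φ`, `|s| ≤ M`, stay in a box
  have hbox : ∀ M s x, |s| ≤ M → |u x + s * φ x| ≤ S + M * S ∧ |u' x + s * φ' x| ≤ S + M * S
      ∧ |u'' x + s * φ'' x| ≤ S + M * S := by
    intro M s x hs
    have aux : ∀ p q P Q : ℝ, |p| ≤ P → |q| ≤ Q → P ≤ S → Q ≤ S → |p + s * q| ≤ S + M * S := by
      intro p q P Q hp hq hP hQ
      calc |p + s * q| ≤ |p| + |s * q| := abs_add_le _ _
        _ ≤ S + M * S := by
          rw [abs_mul]
          exact add_le_add (hp.trans hP) (mul_le_mul hs (hq.trans hQ) (abs_nonneg _)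
            ((abs_nonneg _).trans hs))
    refine ⟨aux _ _ _ _ (bu x) (bφ x) ?_ ?_, aux _ _ _ _ (bu' x) (bφ' x) ?_ ?_,
      aux _ _ _ _ (bu'' x) (bφ'' x) ?_ ?_⟩ <;> simp only [S] <;> linarith
  have hWb : ∀ M, ∃ C, 0 ≤ C ∧ ∀ s x, |s| ≤ M → |W s x| ≤ C := by
    intro M
    obtain ⟨C, hC0, hC⟩ := exists_bound_on_box (continuous_varDeriv cf cg cF) (S + M * S)
    exact ⟨C, hC0, fun s x hs => hC _ _ _ (hbox M s x hs).1 (hbox M s x hs).2.1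
      (hbox M s x hs).2.2⟩
  let J : ℝ → ℝ := fun s => ∫ x, W s x * φ x
  have hJ : Continuous J := by
    rw [continuous_iff_continuousAt]
    intro s₀
    obtain ⟨C, hC0, hC⟩ := hWb (|s₀| + 1)
    refine continuousAt_of_dominated (bound := fun x => C * |φ x|) ?_ ?_ ?_ ?_
    · exact Filter.Eventually.of_forall fun s =>
        ((cW.comp (Continuous.prodMk_right s)).mul cφ).aestronglyMeasurable
    · filter_upwards [Metric.ball_mem_nhds s₀ one_pos] with s hs
      refine Filter.Eventually.of_forall fun x => ?_
      rw [Real.norm_eq_abs, abs_mul]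
      refine mul_le_mul_of_nonneg_right (hC s x ?_) (abs_nonneg _)
      rw [Metric.mem_ball, Real.dist_eq] at hs
      linarith [abs_sub_abs_le_abs_sub s s₀]
    · exact (φ.integrable.abs).const_mul C
    · exact Filter.Eventually.of_forall fun x =>
        (((cW.comp (Continuous.prodMk_left x)).mul continuous_const).continuousAt)
  have hJ0 : J 0 = ∫ x, varDeriv f g F (u x) (u' x) (u'' x) * φ x := by simp [J, W]
  rw [← hJ0]
  refine hasDerivAt_of_sub_eq_integral hJ fun ε => ?_
  have iL : ∀ s : ℝ, Integrable fun x =>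
      lag F G (u x + s * φ x) (u' x + s * φ' x) (u'' x + s * φ'' x) := fun s =>
    integrable_lag_schwartz cF cG (u + s • φ) (u' + s • φ') (u'' + s • φ'')
  rw [← integral_sub (iL ε) (iL 0)]
  simp only [zero_mul, add_zero]
  have iD := (iL ε).sub (iL 0)
  simp only [zero_mul, add_zero] at iD
  -- The integrated first variation is applied on `[-n, n]`, and the two sides are compared in the
  -- limit `n → ∞`.
  have t1 := intervalIntegral_tendsto_integral iD
    (a := fun n : ℕ => -(n : ℝ)) (b := fun n : ℕ => (n : ℝ)) (l := Filter.atTop)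
    (Filter.tendsto_neg_atTop_atBot.comp tendsto_natCast_atTop_atTop) tendsto_natCast_atTop_atTop
  simp only [Pi.sub_apply, rect] at t1
  refine tendsto_nhds_unique t1 ?_
  obtain ⟨C, hC0, hC⟩ := hWb |ε|
  obtain ⟨D, hD0, hD⟩ := exists_bound_on_box (continuous_box_coeff cF cG).1 (S + |ε| * S)
  obtain ⟨E, hE0, hE⟩ := exists_bound_on_box (continuous_box_coeff cF cG).2 (S + |ε| * S)
  -- The boundary term is linear in `(φ, φ')` with coefficients bounded uniformly in `s`. This gives
  -- both the dominating constant and the limit `0` at the endpoints.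
  have hbd : ∀ s x, |s| ≤ |ε| →
      |bdry F G (u x + s * φ x) (u' x + s * φ' x) (φ x) (φ' x)| ≤ D * |φ' x| + E * |φ x| := by
    intro s x hs
    obtain ⟨b1, b2, -⟩ := hbox _ s x hs
    have h1 := hD _ _ _ b1 b2 b1
    have h2 := hE _ _ _ b1 b2 b1
    unfold bdry
    refine (abs_add_le _ _).trans (add_le_add ?_ ?_)
    · rw [neg_mul, abs_mul, abs_neg]
      exact mul_le_mul_of_nonneg_right h1 (abs_nonneg _)
    · rw [abs_mul]
      exact mul_le_mul_of_nonneg_right h2 (abs_nonneg _)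
  have hsε : ∀ s, s ∈ Set.uIoc 0 ε → |s| ≤ |ε| := by
    intro s hs
    rcases le_total 0 ε with h | h
    · rw [Set.uIoc_of_le h] at hs
      rw [abs_of_pos hs.1, abs_of_nonneg h]; exact hs.2
    · rw [Set.uIoc_of_ge h] at hs
      rw [abs_of_nonpos hs.2, abs_of_nonpos h]; linarith [hs.1]
  have cB : ∀ e : ℝ, Continuous fun s : ℝ =>
      bdry F G (u e + s * φ e) (u' e + s * φ' e) (φ e) (φ' e) := by
    intro e
    have c1 := continuous_uncurry_comp cF (X := ℝ) (a := fun s => u e + s * φ e)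
      (b := fun s => u' e + s * φ' e) (by fun_prop) (by fun_prop)
    have c2 := continuous_uncurry_comp cG (X := ℝ) (a := fun s => u e + s * φ e)
      (b := fun s => u' e + s * φ' e) (by fun_prop) (by fun_prop)
    simp only [bdry]
    fun_prop
  refine intervalIntegral.tendsto_integral_filter_of_dominated_convergence
    (fun _ => C * (∫ x, |φ x|) + ((D * K4 + E * K3) + (D * K4 + E * K3))) ?_ ?_
    intervalIntegrable_const ?_
  · refine Filter.Eventually.of_forall fun n => Continuous.aestronglyMeasurable ?_
    refine Continuous.add ?_ ((cB n).sub (cB (-n)))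
    refine intervalIntegral.continuous_parametric_intervalIntegral_of_continuous'
      (f := fun s x => W s x * φ x) ?_ _ _
    exact cW.mul (cφ.comp continuous_snd)
  · refine Filter.Eventually.of_forall fun n => Filter.Eventually.of_forall fun s hs => ?_
    have hs' := hsε s hs
    refine (norm_add_le _ _).trans (add_le_add ?_ ((norm_sub_le _ _).trans (add_le_add ?_ ?_)))
    · have hn : -(n : ℝ) ≤ n := by linarith [n.cast_nonneg (α := ℝ)]
      rw [intervalIntegral.integral_of_le hn]
      calc _ ≤ ∫ x in Set.Ioc (-(n : ℝ)) n, C * |φ x| := by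
            refine norm_integral_le_of_norm_le
              (Integrable.integrableOn ((φ.integrable.abs).const_mul C))
              (Filter.Eventually.of_forall fun x => ?_)
            rw [Real.norm_eq_abs, abs_mul]
            exact mul_le_mul_of_nonneg_right (hC s x hs') (abs_nonneg _)
        _ ≤ ∫ x, C * |φ x| := setIntegral_le_integral ((φ.integrable.abs).const_mul C)
            (Filter.Eventually.of_forall fun x => mul_nonneg hC0 (abs_nonneg _))
        _ = _ := integral_const_mul _ _
    · exact (hbd s _ hs').trans (add_le_add (mul_le_mul_of_nonneg_left (bφ' _) hD0)
        (mul_le_mul_of_nonneg_left (bφ _) hE0))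
    · exact (hbd s _ hs').trans (add_le_add (mul_le_mul_of_nonneg_left (bφ' _) hD0)
        (mul_le_mul_of_nonneg_left (bφ _) hE0))
  · refine Filter.Eventually.of_forall fun s hs => ?_
    have hs' := hsε s hs
    have tn : Filter.Tendsto (fun n : ℕ => (n : ℝ)) Filter.atTop Filter.atTop :=
      tendsto_natCast_atTop_atTop
    have tn' : Filter.Tendsto (fun n : ℕ => -(n : ℝ)) Filter.atTop Filter.atBot :=
      Filter.tendsto_neg_atTop_atBot.comp tn
    have tz : ∀ (e : ℕ → ℝ), Filter.Tendsto (fun n => φ (e n)) Filter.atTop (nhds 0) →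
        Filter.Tendsto (fun n => φ' (e n)) Filter.atTop (nhds 0) →
        Filter.Tendsto (fun n => bdry F G (u (e n) + s * φ (e n)) (u' (e n) + s * φ' (e n))
          (φ (e n)) (φ' (e n))) Filter.atTop (nhds 0) := by
      intro e h1 h2
      refine squeeze_zero_norm (fun n => hbd s (e n) hs') ?_
      simpa using (h2.abs.const_mul D).add (h1.abs.const_mul E)
    have t2 := intervalIntegral_tendsto_integral (integrable_bdd_mul_schwartz
      (cW.comp (Continuous.prodMk_right s)) (fun x => hC s x hs') φ) tn' tn
    have := t2.add ((tz _ ((schwartz_tendsto_zero φ).1.comp tn)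
      ((schwartz_tendsto_zero φ').1.comp tn)).sub (tz _ ((schwartz_tendsto_zero φ).2.comp tn')
      ((schwartz_tendsto_zero φ').2.comp tn')))
    simpa using this

theorem isSchwartzHamiltonian_ofBranches {fp fm gp gm : ℝ → ℝ} (hfp : Continuous fp)
    (hfm : Continuous fm) (hgp : Continuous gp) (hgm : Continuous gm) (hf0 : fp 0 = fm 0)
    (hg0 : gp 0 = gm 0) :
    IsSchwartzHamiltonian
      (fun u v => v * ofBranches fp fm u v)
      (fun u v => u * ofBranches fp fm u v + ofBranches gp gm u v)
      (density (ofBranches (primitive fp) (primitive fm))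
        (ofBranches (average gp) (average gm))) := by
  intro u
  have cf := continuous_ofBranches hfp hfm hf0
  have cg := continuous_ofBranches hgp hgm hg0
  have cF := continuous_ofBranches_primitive hfp hfm
  have cG := continuous_ofBranches_average hgp hgm hg0
  obtain ⟨u', eu1⟩ := schwartz_exists_deriv u
  obtain ⟨u'', eu2⟩ := schwartz_exists_deriv u'
  refine ⟨?_, ?_⟩
  · simp only [density_jet, eu1, eu2]
    exact integrable_lag_schwartz cF cG u u' u''
  obtain ⟨K0, hK0, bu⟩ := schwartz_exists_abs_le u
  obtain ⟨K1, hK1, bu'⟩ := schwartz_exists_abs_le u'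
  obtain ⟨K2, hK2, bu''⟩ := schwartz_exists_abs_le u''
  obtain ⟨C, hC0, hC⟩ := exists_bound_on_box (continuous_varDeriv cf cg cF) (K0 + K1 + K2)
  have cW := continuous_varDeriv_comp cf cg cF u.continuous u'.continuous u''.continuous
  have bW : ∀ x, |varDeriv (ofBranches fp fm) (ofBranches gp gm)
      (ofBranches (primitive fp) (primitive fm)) (u x) (u' x) (u'' x)| ≤ C := fun x =>
    hC _ _ _ (by linarith [bu x]) (by linarith [bu' x]) (by linarith [bu'' x])
  obtain ⟨ψ, h1, h2, h3, h4⟩ := exists_bounded_helm_eq cW bW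
  refine ⟨ψ, h1, ⟨C, h3⟩, fun φ => ?_, ?_⟩
  · rw [integral_mul_helm_schwartz h1 h3 h4 (C' := C) (fun x => by rw [h2]; exact bW x)]
    have := hasDerivAt_functional_schwartz hfp hfm hgp hgm hf0 hg0 u φ
    simp only [eu1, eu2] at this
    simpa only [h2] using this
  · refine flowEq_of_helm_eq hfp hfm hf0 cg (u.smooth ⊤) fun x => ?_
    rw [h2, eu1, eu2]

/-! ### Necessity: δH/δu as a local field -/

theorem jet_congr {u w : ℝ → ℝ} {x : ℝ} (h : u =ᶠ[nhds x] w) (k : ℕ) : jet k u x = jet k w x :=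
  funext fun i => h.iteratedDeriv_eq i

theorem helm_congr {u w : ℝ → ℝ} {x : ℝ} (h : u =ᶠ[nhds x] w) : helm u x = helm w x := by
  rw [helm, helm, h.eq_of_nhds, h.iteratedDeriv_eq]

/-- The variational derivative `δH/δu = Δ δH/δm` of a Hamiltonian density: it is a local
expression in `u`, and equals `g m + ∂⁻¹(f m)`. -/
theorem IsHamiltonianDensity.exists_field {f g : ℝ → ℝ → ℝ} {k : ℕ}
    {B : ℝ → (Fin (k + 1) → ℝ) → ℝ} (hf : Continuous (Function.uncurry f))
    (hg : Continuous (Function.uncurry g)) (hB : IsHamiltonianDensity f g B) :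
    ∃ W : (ℝ → ℝ) → ℝ → ℝ,
      (∀ u, ContDiff ℝ ∞ u → ∀ φ, IsTest φ → HasDerivAt
        (fun ε : ℝ => ∫ x, (B x (jet k (fun y => u y + ε * φ y) x) - B x (jet k u x)))
        (∫ x, W u x * φ x) 0) ∧
      (∀ u, ContDiff ℝ ∞ u → ∀ a b, (W u b - g (u b) (deriv u b) * helm u b)
        - (W u a - g (u a) (deriv u a) * helm u a)
          = ∫ x in a..b, f (u x) (deriv u x) * helm u x) ∧
      (∀ u w, ContDiff ℝ ∞ u → ContDiff ℝ ∞ w → ∀ a, u =ᶠ[nhds a] w → W u a = W w a) := by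
  -- The implication inside the existential, with default value `0`, lets `ψ` be chosen as a
  -- function of every `u`, smooth or not.
  have hex : ∀ u : ℝ → ℝ, ∃ ψ : ℝ → ℝ, ContDiff ℝ ∞ u → ContDiff ℝ 2 ψ ∧
      IsVarDerivMomentum B u ψ ∧ FlowEq f g u ψ := fun u => by
    by_cases hu : ContDiff ℝ ∞ u
    · obtain ⟨ψ, h⟩ := hB.2 u hu
      exact ⟨ψ, fun _ => h⟩
    · exact ⟨0, fun h => absurd h hu⟩
  choose ψ hψ using hex
  have hvar : ∀ u, ContDiff ℝ ∞ u → ∀ φ, IsTest φ → HasDerivAt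
      (fun ε : ℝ => ∫ x, (B x (jet k (fun y => u y + ε * φ y) x) - B x (jet k u x)))
      (∫ x, helm (ψ u) x * φ x) 0 := fun u hu φ hφ => by
    rw [← integral_mul_helm (hψ u hu).1 hφ]
    exact (hψ u hu).2.1 φ hφ
  refine ⟨fun u => helm (ψ u), hvar, fun u hu a b => ?_, fun u w hu hw a ha => ?_⟩
  · have cm := continuous_helm hu
    have cu' := (smooth_deriv hu).continuous
    have cfm : Continuous fun x => f (u x) (deriv u x) * helm u x :=
      (continuous_uncurry_comp hf hu.continuous cu').mul cm
    have cgm : Continuous fun x => g (u x) (deriv u x) * helm u x :=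
      (continuous_uncurry_comp hg hu.continuous cu').mul cm
    have cψ := continuous_helm_of_contDiff_two (hψ u hu).1
    have dΦ : ∀ x, HasDerivAt (fun x => ∫ t in (0 : ℝ)..x, f (u t) (deriv u t) * helm u t)
        (f (u x) (deriv u x) * helm u x) x := fun x => (cfm.integral_hasStrictDerivAt 0 x).hasDerivAt
    have cΦ : Continuous fun x => ∫ t in (0 : ℝ)..x, f (u t) (deriv u t) * helm u t :=
      continuous_iff_continuousAt.2 fun x => (dΦ x).continuousAt
    obtain ⟨c, hc⟩ := eq_const_of_integral_deriv_test_eq_zero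
      (k := fun x => helm (ψ u) x - g (u x) (deriv u x) * helm u x
        - ∫ t in (0 : ℝ)..x, f (u t) (deriv u t) * helm u t) ((cψ.sub cgm).sub cΦ) (by
      intro χ hχ
      have flow := (hψ u hu).2.2 χ hχ
      have cχ := hχ.1.continuous
      have cχ' := (smooth_deriv hχ.1).continuous
      have key := integral_eq_zero_of_hasCompactSupport
        (fun x => (dΦ x).mul (smooth_hasDerivAt hχ.1 x))
        ((cfm.mul cχ).add (cΦ.mul cχ')) hχ.2.mul_left
      have i1 : Integrable fun x => helm (ψ u) x * deriv χ x :=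
        (cψ.mul cχ').integrable_of_hasCompactSupport hχ.deriv.2.mul_left
      have i2 : Integrable fun x => f (u x) (deriv u x) * helm u x * χ x
          - g (u x) (deriv u x) * helm u x * deriv χ x :=
        ((cfm.mul cχ).sub (cgm.mul cχ')).integrable_of_hasCompactSupport
          (hχ.2.mul_left.sub hχ.deriv.2.mul_left)
      have i3 : Integrable fun x => f (u x) (deriv u x) * helm u x * χ x
          + (∫ t in (0 : ℝ)..x, f (u t) (deriv u t) * helm u t) * deriv χ x :=
        ((cfm.mul cχ).add (cΦ.mul cχ')).integrable_of_hasCompactSupport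
          (hχ.2.mul_left.add hχ.deriv.2.mul_left)
      have e : ∀ x, (helm (ψ u) x - g (u x) (deriv u x) * helm u x
          - ∫ t in (0 : ℝ)..x, f (u t) (deriv u t) * helm u t) * deriv χ x
          = (helm (ψ u) x * deriv χ x + (f (u x) (deriv u x) * helm u x * χ x
          - g (u x) (deriv u x) * helm u x * deriv χ x))
          - (f (u x) (deriv u x) * helm u x * χ x
          + (∫ t in (0 : ℝ)..x, f (u t) (deriv u t) * helm u t) * deriv χ x) := fun x => by ring
      have i12 : Integrable fun x => helm (ψ u) x * deriv χ x
          + (f (u x) (deriv u x) * helm u x * χ x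
          - g (u x) (deriv u x) * helm u x * deriv χ x) := i1.add i2
      simp only [e]
      rw [integral_sub i12 i3, integral_add i1 i2, flow, key]
      ring)
    have ha := hc a
    have hb := hc b
    have hadd := intervalIntegral.integral_add_adjacent_intervals
      (cfm.intervalIntegrable (μ := volume) 0 a) (cfm.intervalIntegrable a b)
    simp only at ha hb hadd ⊢
    linarith
  · obtain ⟨S, hS, hSo, haS⟩ := eventually_nhds_iff.1 ha
    have hcont : Continuous fun x => helm (ψ u) x - helm (ψ w) x :=
      (continuous_helm_of_contDiff_two (hψ u hu).1).sub
        (continuous_helm_of_contDiff_two (hψ w hw).1)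
    -- Variations supported where `u = w` change the density of both functions in the same way, so
    -- the two first variations agree against all of them.
    refine sub_eq_zero.1 (eq_zero_of_integral_test_eq_zero hcont hSo (fun φ hφ hφS => ?_) a haS)
    have e : (fun ε : ℝ => ∫ x, (B x (jet k (fun y => u y + ε * φ y) x) - B x (jet k u x)))
        = fun ε : ℝ => ∫ x, (B x (jet k (fun y => w y + ε * φ y) x) - B x (jet k w x)) := by
      funext ε
      congr 1
      funext x
      by_cases hx : x ∈ S
      · have hev : u =ᶠ[nhds x] w := Filter.eventually_of_mem (hSo.mem_nhds hx) hS
        have hev' : (fun y => u y + ε * φ y) =ᶠ[nhds x] fun y => w y + ε * φ y := by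
          filter_upwards [hev] with y hy
          rw [hy]
        rw [jet_congr hev, jet_congr hev']
      · have hφ0 : φ =ᶠ[nhds x] 0 := notMem_tsupport_iff_eventuallyEq.1 fun h => hx (hφS h)
        have h1 : ∀ v : ℝ → ℝ, (fun y => v y + ε * φ y) =ᶠ[nhds x] v := fun v => by
          filter_upwards [hφ0] with y hy
          simp [hy]
        rw [jet_congr (h1 u), jet_congr (h1 w), sub_self, sub_self]
    have h1 := hvar u hu φ hφ
    rw [e] at h1
    have := h1.unique (hvar w hw φ hφ)
    have i : ∀ v, ContDiff ℝ ∞ v → Integrable fun x => helm (ψ v) x * φ x := fun v hv =>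
      ((continuous_helm_of_contDiff_two (hψ v hv).1).mul
        hφ.1.continuous).integrable_of_hasCompactSupport hφ.2.mul_left
    simp only [sub_mul]
    rw [integral_sub (i u hu) (i w hw), this, sub_self]

/-! ### Local primitives of f m -/

/-- A local primitive of `f(u,u_x) m` depends only on the `1`-jet of `u`. -/
theorem local_primitive_eq_of_jet_eq {f : ℝ → ℝ → ℝ} (hf : Continuous (Function.uncurry f))
    {q : (ℝ → ℝ) → ℝ → ℝ}
    (hint : ∀ u, ContDiff ℝ ∞ u → ∀ a b, q u b - q u a
      = ∫ x in a..b, f (u x) (deriv u x) * helm u x)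
    (hloc : ∀ u w, ContDiff ℝ ∞ u → ContDiff ℝ ∞ w → ∀ a, u =ᶠ[nhds a] w → q u a = q w a)
    {u w : ℝ → ℝ} (hu : ContDiff ℝ ∞ u) (hw : ContDiff ℝ ∞ w) {a : ℝ} (h0 : u a = w a)
    (h1 : deriv u a = deriv w a) : q u a = q w a := by
  let θ : ContDiffBump (0 : ℝ) := ⟨1 / 2, 1, by norm_num, by norm_num⟩
  have hθ : ContDiff ℝ ∞ (θ : ℝ → ℝ) := θ.contDiff
  have hθt : IsTest (θ : ℝ → ℝ) := ⟨hθ, θ.hasCompactSupport⟩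
  obtain ⟨T0, hT0⟩ := hθt.2.exists_bound_of_continuous hθ.continuous
  obtain ⟨T1, hT1⟩ := hθt.deriv.2.exists_bound_of_continuous hθt.deriv.1.continuous
  obtain ⟨T2, hT2⟩ := hθt.deriv.deriv.2.exists_bound_of_continuous hθt.deriv.deriv.1.continuous
  simp only [Real.norm_eq_abs] at hT0 hT1 hT2
  have pT0 : 0 ≤ T0 := (abs_nonneg _).trans (hT0 0)
  have pT1 : 0 ≤ T1 := (abs_nonneg _).trans (hT1 0)
  have pT2 : 0 ≤ T2 := (abs_nonneg _).trans (hT2 0)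
  let d : ℝ → ℝ := fun x => w x - u x
  have hd : ContDiff ℝ ∞ d := hw.sub hu
  have hd0 : d a = 0 := by simp [d, h0]
  have hd1 : deriv d a = 0 := by
    have : deriv d a = deriv w a - deriv u a :=
      ((smooth_hasDerivAt hw a).sub (smooth_hasDerivAt hu a)).deriv
    rw [this, h1, sub_self]
  have bddOn : ∀ v : ℝ → ℝ, Continuous v → ∃ C, 0 ≤ C ∧ ∀ x ∈ Set.Icc (a - 2) a, |v x| ≤ C := by
    intro v hv
    obtain ⟨C, hC⟩ := (isCompact_Icc (a := a - 2) (b := a)).exists_bound_of_continuousOn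
      hv.continuousOn
    exact ⟨max C 0, le_max_right _ _, fun x hx => (hC x hx).trans (le_max_left _ _)⟩
  obtain ⟨D, pD, hD⟩ := bddOn _ (smooth_deriv (smooth_deriv hd)).continuous
  obtain ⟨K0, pK0, hK0⟩ := bddOn _ hu.continuous
  obtain ⟨K1, pK1, hK1⟩ := bddOn _ (smooth_deriv hu).continuous
  obtain ⟨K2, pK2, hK2⟩ := bddOn _ (smooth_deriv (smooth_deriv hu)).continuous
  -- A bound on `[a - 2δ, a]` for the 2-jets of `u` and of every interpolant `v` below, independent
  -- of `δ`.
  let R := K0 + K1 + K2 + 4 * D * (T0 + T1 + T2)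
  have hc : Continuous fun z : ℝ × ℝ × ℝ => f z.1 z.2.1 * (z.1 - z.2.2) :=
    (continuous_uncurry_comp hf (X := ℝ × ℝ × ℝ) (a := fun z => z.1) (b := fun z => z.2.1)
      (by fun_prop) (by fun_prop)).mul (by fun_prop)
  obtain ⟨C, pC, hC⟩ := exists_bound_on_box hc R
  have main : ∀ δ : ℝ, 0 < δ → δ ≤ 1 → |q w a - q u a| ≤ 4 * C * δ := by
    intro δ hδ hδ1
    -- `v` coincides with `w` near `a` and with `u` at distance more than `δ` from `a`.
    let v : ℝ → ℝ := fun x => u x + d x * θ ((x - a) / δ)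
    have hlin : ContDiff ℝ ∞ fun x : ℝ => (x - a) / δ := by fun_prop
    have hv : ContDiff ℝ ∞ v := hu.add (hd.mul (hθ.comp hlin))
    have dlin : ∀ x : ℝ, HasDerivAt (fun x : ℝ => (x - a) / δ) (1 / δ) x := fun x =>
      ((hasDerivAt_id x).sub_const a).div_const δ
    have dθ : ∀ x, HasDerivAt (fun x => θ ((x - a) / δ)) (deriv θ ((x - a) / δ) * (1 / δ)) x :=
      fun x => (smooth_hasDerivAt hθ _).comp x (dlin x)
    have dθ' : ∀ x, HasDerivAt (fun x => deriv θ ((x - a) / δ))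
        (deriv (deriv θ) ((x - a) / δ) * (1 / δ)) x :=
      fun x => (smooth_hasDerivAt (smooth_deriv hθ) _).comp x (dlin x)
    have dv : deriv v = fun x => deriv u x + (deriv d x * θ ((x - a) / δ)
        + d x * (deriv θ ((x - a) / δ) * (1 / δ))) := funext fun x =>
      ((smooth_hasDerivAt hu x).add ((smooth_hasDerivAt hd x).mul (dθ x))).deriv
    have ddv : deriv (deriv v) = fun x => deriv (deriv u) x + ((deriv (deriv d) x * θ ((x - a) / δ)
        + deriv d x * (deriv θ ((x - a) / δ) * (1 / δ)))
        + (deriv d x * (deriv θ ((x - a) / δ) * (1 / δ))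
        + d x * (deriv (deriv θ) ((x - a) / δ) * (1 / δ) * (1 / δ)))) := by
      rw [dv]
      exact funext fun x => ((smooth_hasDerivAt (smooth_deriv hu) x).add
        (((smooth_hasDerivAt (smooth_deriv hd) x).mul (dθ x)).add
        ((smooth_hasDerivAt hd x).mul ((dθ' x).mul_const (1 / δ))))).deriv
    have hsub : Set.Icc (a - 2 * δ) a ⊆ Set.Icc (a - 2) a := Set.Icc_subset_Icc (by linarith) le_rfl
    -- As `d` has vanishing 1-jet at `a`, `d' = O(δ)` and `d = O(δ²)` here; this compensates the
    -- factors `1/δ` and `1/δ²` from differentiating the cutoff.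
    have bd1 : ∀ x ∈ Set.Icc (a - 2 * δ) a, |deriv d x| ≤ 2 * D * δ := by
      intro x hx
      have := (convex_Icc (a - 2 * δ) a).norm_image_sub_le_of_norm_deriv_le (f := deriv d)
        (fun y _ => (smooth_hasDerivAt (smooth_deriv hd) y).differentiableAt)
        (fun y hy => hD y (hsub hy)) (Set.right_mem_Icc.2 (by linarith)) hx
      rw [hd1, sub_zero, Real.norm_eq_abs, Real.norm_eq_abs] at this
      refine this.trans ?_
      have h : |x - a| ≤ 2 * δ := by rw [abs_le]; constructor <;> linarith [hx.1, hx.2]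
      calc D * |x - a| ≤ D * (2 * δ) := mul_le_mul_of_nonneg_left h pD
        _ = 2 * D * δ := by ring
    have bd0 : ∀ x ∈ Set.Icc (a - 2 * δ) a, |d x| ≤ 4 * D * δ * δ := by
      intro x hx
      have := (convex_Icc (a - 2 * δ) a).norm_image_sub_le_of_norm_deriv_le (f := d)
        (fun y _ => (smooth_hasDerivAt hd y).differentiableAt)
        (fun y hy => bd1 y hy) (Set.right_mem_Icc.2 (by linarith)) hx
      rw [hd0, sub_zero, Real.norm_eq_abs, Real.norm_eq_abs] at this
      refine this.trans ?_
      have h : |x - a| ≤ 2 * δ := by rw [abs_le]; constructor <;> linarith [hx.1, hx.2]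
      calc 2 * D * δ * |x - a| ≤ 2 * D * δ * (2 * δ) := mul_le_mul_of_nonneg_left h (by positivity)
        _ = _ := by ring
    have mulb : ∀ {p q P Q : ℝ}, |p| ≤ P → |q| ≤ Q → |p * q| ≤ P * Q := fun hp hq => by
      rw [abs_mul]
      exact mul_le_mul hp hq (abs_nonneg _) ((abs_nonneg _).trans hp)
    have bδ : |1 / δ| ≤ 1 / δ := le_of_eq (abs_of_pos (by positivity))
    have bv : ∀ x ∈ Set.Icc (a - 2 * δ) a, |v x| ≤ R ∧ |deriv v x| ≤ R ∧ |deriv (deriv v) x| ≤ R := by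
      intro x hx
      have e0 := bd0 x hx
      have e1 := bd1 x hx
      have e2 := hD x (hsub hx)
      have t0 := hT0 ((x - a) / δ)
      have t1 := hT1 ((x - a) / δ)
      have t2 := hT2 ((x - a) / δ)
      have k0 := hK0 x (hsub hx)
      have k1 := hK1 x (hsub hx)
      have k2 := hK2 x (hsub hx)
      have pT : 0 ≤ D * T0 ∧ 0 ≤ D * T1 ∧ 0 ≤ D * T2 :=
        ⟨by positivity, by positivity, by positivity⟩
      have sd : δ * δ ≤ 1 := by nlinarith
      have m1 : |d x * θ ((x - a) / δ)| ≤ 4 * D * T0 := by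
        refine (mulb e0 t0).trans ?_
        nlinarith [pT.1]
      have m2 : |deriv d x * θ ((x - a) / δ)| ≤ 2 * D * T0 := by
        refine (mulb e1 t0).trans ?_
        nlinarith [pT.1]
      have m3 : |d x * (deriv θ ((x - a) / δ) * (1 / δ))| ≤ 4 * D * T1 := by
        refine (mulb e0 (mulb t1 bδ)).trans ?_
        have : 4 * D * δ * δ * (T1 * (1 / δ)) = 4 * (D * T1) * δ := by field_simp
        rw [this]
        nlinarith [pT.2.1]
      have m4 : |deriv (deriv d) x * θ ((x - a) / δ)| ≤ D * T0 := mulb e2 t0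
      have m5 : |deriv d x * (deriv θ ((x - a) / δ) * (1 / δ))| ≤ 2 * D * T1 := by
        refine (mulb e1 (mulb t1 bδ)).trans (le_of_eq ?_)
        field_simp
      have m6 : |d x * (deriv (deriv θ) ((x - a) / δ) * (1 / δ) * (1 / δ))| ≤ 4 * D * T2 := by
        refine (mulb e0 (mulb (mulb t2 bδ) bδ)).trans (le_of_eq ?_)
        field_simp
      rw [ddv, dv]
      simp only [v, R]
      rw [abs_le] at k0 k1 k2 m1 m2 m3 m4 m5 m6
      refine ⟨?_, ?_, ?_⟩ <;> rw [abs_le] <;> constructor <;>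
        linarith [pT.1, pT.2.1, pT.2.2, k0.1, k0.2, k1.1, k1.2, k2.1, k2.2, m1.1, m1.2, m2.1, m2.2,
          m3.1, m3.2, m4.1, m4.2, m5.1, m5.2, m6.1, m6.2]
    have bint : ∀ y : ℝ → ℝ, (∀ x ∈ Set.Icc (a - 2 * δ) a,
        |y x| ≤ R ∧ |deriv y x| ≤ R ∧ |deriv (deriv y) x| ≤ R) →
        |∫ x in (a - 2 * δ)..a, f (y x) (deriv y x) * helm y x| ≤ C * (2 * δ) := by
      intro y hy
      have := intervalIntegral.norm_integral_le_of_norm_le_const (a := a - 2 * δ) (b := a)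
        (f := fun x => f (y x) (deriv y x) * helm y x) (C := C) (fun x hx => by
          rw [Set.uIoc_of_le (by linarith)] at hx
          obtain ⟨b0, b1, b2⟩ := hy x (Set.Ioc_subset_Icc_self hx)
          rw [helm_eq]
          exact hC _ _ _ b0 b1 b2)
      rwa [Real.norm_eq_abs, show a - (a - 2 * δ) = 2 * δ by ring,
        abs_of_pos (by linarith : (0 : ℝ) < 2 * δ)] at this
    have bu : ∀ x ∈ Set.Icc (a - 2 * δ) a,
        |u x| ≤ R ∧ |deriv u x| ≤ R ∧ |deriv (deriv u) x| ≤ R := by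
      intro x hx
      have : 0 ≤ 4 * D * (T0 + T1 + T2) := by positivity
      simp only [R]
      refine ⟨?_, ?_, ?_⟩ <;> linarith [hK0 x (hsub hx), hK1 x (hsub hx), hK2 x (hsub hx)]
    have l1 : q v a = q w a := by
      refine hloc v w hv hw a ?_
      have : ∀ᶠ x in nhds a, (x - a) / δ ∈ Metric.closedBall (0 : ℝ) (1 / 2) := by
        refine (hlin.continuous.continuousAt (x := a)).eventually ?_
        simp only [sub_self, zero_div]
        exact Metric.closedBall_mem_nhds (0 : ℝ) (by norm_num : (0 : ℝ) < 1 / 2)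
      filter_upwards [this] with x hx
      simp only [v, θ.one_of_mem_closedBall hx, d]
      ring
    have l2 : q v (a - 2 * δ) = q u (a - 2 * δ) := by
      refine hloc v u hv hu _ ?_
      filter_upwards [gt_mem_nhds (show a - 2 * δ < a - δ by linarith)] with x hx
      have : θ ((x - a) / δ) = 0 := by
        refine θ.zero_of_le_dist ?_
        rw [dist_zero_right, Real.norm_eq_abs, abs_div, abs_of_pos hδ, le_div_iff₀ hδ,
          abs_of_nonpos (by linarith)]
        simp only [θ]
        linarith
      simp only [v, this]
      ring
    -- `q v` and `q u` agree at `a - 2δ`, while `q v` and `q w` agree at `a`. Hence `q w a - q u a`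
    -- is the difference of two integrals over an interval of length `2δ`, each at most `2Cδ`.
    have i1 := hint v hv (a - 2 * δ) a
    have i2 := hint u hu (a - 2 * δ) a
    have b1 := abs_le.1 (bint v bv)
    have b2 := abs_le.1 (bint u bu)
    rw [abs_le]
    constructor <;> linarith
  by_contra hne
  have hpos : 0 < |q w a - q u a| := abs_pos.2 fun h => hne (sub_eq_zero.1 h).symm
  set r := |q w a - q u a|
  have hδ : 0 < min 1 (r / (8 * (C + 1))) := lt_min one_pos (by positivity)
  have h2 := main _ hδ (min_le_left _ _)
  have h3 : 4 * C * min 1 (r / (8 * (C + 1))) ≤ 4 * (C + 1) * (r / (8 * (C + 1))) :=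
    mul_le_mul (by linarith) (min_le_right _ _) hδ.le (by positivity)
  have h4 : 4 * (C + 1) * (r / (8 * (C + 1))) = r / 2 := by field_simp; norm_num
  linarith

/-- The cubic polynomial with `1`-jet `0` at `a - 1` and `(p, r)` at `a`. -/
def hermite (p r a x : ℝ) : ℝ :=
  (3 * p - r) * (x - a + 1) ^ 2 + (r - 2 * p) * (x - a + 1) ^ 3

theorem contDiff_hermite (p r a : ℝ) : ContDiff ℝ ∞ (hermite p r a) := by
  unfold hermite; fun_prop

theorem deriv_hermite (p r a : ℝ) : deriv (hermite p r a) = fun x =>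
    (3 * p - r) * (2 * (x - a + 1)) + (r - 2 * p) * (3 * (x - a + 1) ^ 2) := by
  funext x
  have h : HasDerivAt (fun x : ℝ => x - a + 1) 1 x := ((hasDerivAt_id x).sub_const a).add_const 1
  have := ((h.pow 2).const_mul (3 * p - r)).add ((h.pow 3).const_mul (r - 2 * p))
  refine (this.congr_deriv ?_).deriv
  norm_num

theorem deriv_deriv_hermite (p r a : ℝ) : deriv (deriv (hermite p r a)) = fun x =>
    (3 * p - r) * 2 + (r - 2 * p) * (6 * (x - a + 1)) := by
  rw [deriv_hermite]
  funext x
  have h : HasDerivAt (fun x : ℝ => x - a + 1) 1 x := ((hasDerivAt_id x).sub_const a).add_const 1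
  have := ((h.const_mul 2).const_mul (3 * p - r)).add
    (((h.pow 2).const_mul 3).const_mul (r - 2 * p))
  refine (this.congr_deriv ?_).deriv
  simp only [show 2 - 1 = 1 from rfl, pow_one]
  push_cast
  ring

/-- A local primitive of `f(u,u_x) m` is a function of `(u, u_x)`. -/
theorem exists_potential {f : ℝ → ℝ → ℝ} (hf : Continuous (Function.uncurry f))
    {q : (ℝ → ℝ) → ℝ → ℝ}
    (hint : ∀ u, ContDiff ℝ ∞ u → ∀ a b, q u b - q u a
      = ∫ x in a..b, f (u x) (deriv u x) * helm u x)
    (hloc : ∀ u w, ContDiff ℝ ∞ u → ContDiff ℝ ∞ w → ∀ a, u =ᶠ[nhds a] w → q u a = q w a) :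
    ∃ p : ℝ → ℝ → ℝ, ∀ u, ContDiff ℝ ∞ u → ∀ a, q u a = p (u a) (deriv u a) := by
  -- The potential is the integral of `f m` along a cubic leading from the zero 1-jet to `(p, r)`
  -- over unit length. Translation invariance of the integrand and constancy of `q` on the zero
  -- function remove the dependence on the base point.
  refine ⟨fun p r => q (fun _ => 0) 0 + ∫ x in (-1 : ℝ)..0,
    f (hermite p r 0 x) (deriv (hermite p r 0) x) * helm (hermite p r 0) x, fun u hu a => ?_⟩
  have hz : ContDiff ℝ ∞ fun _ : ℝ => (0 : ℝ) := contDiff_const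
  have h1 : q u a = q (hermite (u a) (deriv u a) a) a := by
    refine local_primitive_eq_of_jet_eq hf hint hloc hu (contDiff_hermite _ _ _) ?_ ?_
    · simp [hermite]; ring
    · rw [deriv_hermite]; simp; ring
  have h2 : q (hermite (u a) (deriv u a) a) (a - 1) = q (fun _ => 0) (a - 1) := by
    refine local_primitive_eq_of_jet_eq hf hint hloc (contDiff_hermite _ _ _) hz ?_ ?_
    · simp [hermite]
    · rw [deriv_hermite]; simp
  have h3 : q (fun _ => 0) (a - 1) = q (fun _ => 0) 0 := by
    have := hint _ hz 0 (a - 1)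
    simp [helm_eq] at this
    linarith
  have h4 := hint _ (contDiff_hermite (u a) (deriv u a) a) (a - 1) a
  have h5 := intervalIntegral.integral_comp_sub_right (a := a - 1) (b := a)
    (fun x => f (hermite (u a) (deriv u a) 0 x) (deriv (hermite (u a) (deriv u a) 0) x)
      * helm (hermite (u a) (deriv u a) 0) x) a
  rw [show a - 1 - a = -1 by ring, sub_self] at h5
  beta_reduce
  rw [← h5, h1]
  have e : ∀ x, f (hermite (u a) (deriv u a) 0 (x - a))
      (deriv (hermite (u a) (deriv u a) 0) (x - a)) * helm (hermite (u a) (deriv u a) 0) (x - a)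
      = f (hermite (u a) (deriv u a) a x) (deriv (hermite (u a) (deriv u a) a) x)
        * helm (hermite (u a) (deriv u a) a) x := by
    intro x
    rw [helm_eq, helm_eq, deriv_deriv_hermite, deriv_deriv_hermite, deriv_hermite, deriv_hermite]
    simp only [hermite, sub_zero]
  simp only [e]
  linarith

/-! ### The form of f -/

theorem contDiff_exp_comb (α β : ℝ) :
    ContDiff ℝ ∞ fun x : ℝ => α * Real.exp x + β * Real.exp (-x) := by fun_prop

theorem deriv_exp_comb (α β : ℝ) : deriv (fun x : ℝ => α * Real.exp x + β * Real.exp (-x))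
    = fun x => α * Real.exp x + (-β) * Real.exp (-x) := by
  funext x
  have he : HasDerivAt (fun x : ℝ => Real.exp (-x)) (-Real.exp (-x)) x := by
    simpa using (hasDerivAt_neg x).exp
  refine ((((Real.hasDerivAt_exp x).const_mul α).add (he.const_mul β)).congr_deriv ?_).deriv
  ring

theorem helm_exp_comb (α β x : ℝ) :
    helm (fun x : ℝ => α * Real.exp x + β * Real.exp (-x)) x = 0 := by
  rw [helm_eq, deriv_exp_comb, deriv_exp_comb]; ring

/-- A function which is constant along the solutions of `u = u_xx` is, on the half-plane
`u + v > 0`, a function of `u² - v²`. -/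
theorem eq_of_const_on_hyperbolas {p : ℝ → ℝ → ℝ}
    (hp : ∀ α β x : ℝ, p (α * Real.exp x + β * Real.exp (-x)) (α * Real.exp x + (-β) * Real.exp (-x))
      = p (α + β) (α + -β)) {u v : ℝ} (h : 0 < u + v) :
    p u v = p ((1 + (u ^ 2 - v ^ 2)) / 2) ((1 - (u ^ 2 - v ^ 2)) / 2) := by
  -- Along the solution with 1-jet `(u, v)` at `0`, the sum of value and slope is `(u + v) eˣ`; at
  -- `x = -log (u + v)` it equals `1`, and the difference is then `u² - v²`.
  have := hp ((u + v) / 2) ((u - v) / 2) (-Real.log (u + v))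
  rw [neg_neg, Real.exp_neg, Real.exp_log h] at this
  rw [show (u + v) / 2 + (u - v) / 2 = u by ring, show (u + v) / 2 + -((u - v) / 2) = v by ring]
    at this
  rw [← this]
  congr 1 <;> field_simp <;> ring

/-- Every point of the closed half-plane is a limit along a ray on which `u + v > 0` and `v ≠ 0`.
The slope `σ = ±1` is taken with the sign of `v`, so that `v` moves away from `0`, while the shift
`2t` of `u` keeps the sum increasing. -/
theorem eq_of_eq_on_open_halfplane {A B : ℝ → ℝ → ℝ} (hA : Continuous (Function.uncurry A))
    (hB : Continuous (Function.uncurry B))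
    (h : ∀ u v, 0 < u + v → v ≠ 0 → A u v = B u v) {u v : ℝ} (huv : 0 ≤ u + v) :
    A u v = B u v := by
  obtain ⟨σ, hσ, hv⟩ : ∃ σ : ℝ, -2 < σ ∧ ∀ t, 0 < t → v + σ * t ≠ 0 := by
    rcases le_or_gt 0 v with h' | h'
    · exact ⟨1, by norm_num, fun t ht => by linarith⟩
    · exact ⟨-1, by norm_num, fun t ht => by linarith⟩
  have c : ∀ {F : ℝ → ℝ → ℝ}, Continuous (Function.uncurry F) → Filter.Tendsto
      (fun t : ℝ => F (u + 2 * t) (v + σ * t)) (nhdsWithin 0 (Set.Ioi 0)) (nhds (F u v)) := by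
    intro F hF
    have := (continuous_uncurry_comp hF (X := ℝ) (a := fun t => u + 2 * t)
      (b := fun t => v + σ * t) (by fun_prop) (by fun_prop)).tendsto 0
    simp only [mul_zero, add_zero] at this
    exact this.mono_left nhdsWithin_le_nhds
  refine tendsto_nhds_unique ((c hA).congr' ?_) (c hB)
  filter_upwards [self_mem_nhdsWithin] with t ht
  have ht : 0 < t := ht
  exact h _ _ (by nlinarith) (hv t ht)

/-- If `f(u,u_x) m` is the `x`-derivative of a function of `(u, u_x)`, then `f = v f₁(u² - v²)` on
the half-plane `u + v ≥ 0`. -/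
theorem exists_invariant_of_potential {f p : ℝ → ℝ → ℝ} (hf : Continuous (Function.uncurry f))
    (hp : ∀ u, ContDiff ℝ ∞ u → ∀ x, HasDerivAt (fun x => p (u x) (deriv u x))
      (f (u x) (deriv u x) * helm u x) x) :
    ∃ h : ℝ → ℝ, Continuous h ∧ ∀ u v, 0 ≤ u + v → f u v = v * h (u ^ 2 - v ^ 2) := by
  have hconst : ∀ α β x : ℝ,
      p (α * Real.exp x + β * Real.exp (-x)) (α * Real.exp x + (-β) * Real.exp (-x))
      = p (α + β) (α + -β) := by
    intro α β x
    have d := hp _ (contDiff_exp_comb α β)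
    simp only [helm_exp_comb, mul_zero] at d
    have := is_const_of_deriv_eq_zero (fun x => (d x).differentiableAt) (fun x => (d x).deriv) x 0
    simpa [deriv_exp_comb] using this
  let π : ℝ → ℝ := fun y => p ((1 + y) / 2) ((1 - y) / 2)
  have hπ : ∀ u v, 0 < u + v → p u v = π (u ^ 2 - v ^ 2) := fun u v h =>
    eq_of_const_on_hyperbolas hconst h
  -- differentiate across the hyperbolas
  have hder : ∀ u v, 0 < u + v → v ≠ 0 → HasDerivAt π (f u v * (2 * v)⁻¹) (u ^ 2 - v ^ 2) := by
    intro u v huv hv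
    -- The 2-jet at `0` is `(u, v, u - 1)`, so `m = 1` there: the potential has derivative `f u v`
    -- along `w`, and `u² - u_x²` has derivative `2v`. As `v ≠ 0`, the inverse function theorem
    -- turns `u² - u_x²` into a parameter.
    let w : ℝ → ℝ := fun x => u + v * x + (u - 1) / 2 * x ^ 2
    have hw : ContDiff ℝ ∞ w := by simp only [w]; fun_prop
    have dw : deriv w = fun x => v + (u - 1) * x := funext fun x => by
      have := ((((hasDerivAt_id x).const_mul v).const_add u).add
        (((hasDerivAt_id x).pow 2).const_mul ((u - 1) / 2)))
      refine (this.congr_deriv ?_).deriv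
      simp; ring
    have ddw : deriv (deriv w) = fun _ => u - 1 := by
      rw [dw]
      funext x
      simp
    have w0 : w 0 = u := by simp [w]
    have dw0 : deriv w 0 = v := by simp [dw]
    have hm : helm w 0 = 1 := by rw [helm_eq, ddw, w0]; ring
    have dp := hp w hw 0
    rw [w0, dw0, hm, mul_one] at dp
    have hy : HasStrictDerivAt (fun x => w x ^ 2 - deriv w x ^ 2) (2 * v) 0 := by
      have s1 : HasStrictDerivAt w v 0 := by
        have := hw.contDiffAt.hasStrictDerivAt (x := 0) (by simp)
        rwa [dw0] at this
      have s2 : HasStrictDerivAt (deriv w) (u - 1) 0 := by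
        have := (smooth_deriv hw).contDiffAt.hasStrictDerivAt (x := 0) (by simp)
        rwa [ddw] at this
      refine ((s1.pow 2).sub (s2.pow 2)).congr_deriv ?_
      simp [w0, dw0]; ring
    have h2v : 2 * v ≠ 0 := mul_ne_zero two_ne_zero hv
    have dinv := (hy.to_localInverse h2v).hasDerivAt
    set e := hy.localInverse _ _ _ h2v with he
    have hy0 : w 0 ^ 2 - deriv w 0 ^ 2 = u ^ 2 - v ^ 2 := by rw [w0, dw0]
    have he0 : e (w 0 ^ 2 - deriv w 0 ^ 2) = 0 :=
      HasStrictFDerivAt.localInverse_apply_image (hy.hasStrictFDerivAt_equiv h2v)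
    have hr := hy.eventually_right_inverse h2v
    rw [← he] at hr
    rw [hy0] at dinv hr he0
    rw [← he0] at dp
    refine (dp.comp _ dinv).congr_of_eventuallyEq ?_
    have hpos : ∀ᶠ x in nhds (0 : ℝ), 0 < w x + deriv w x := by
      have : Continuous fun x => w x + deriv w x := hw.continuous.add (smooth_deriv hw).continuous
      exact this.continuousAt.eventually (lt_mem_nhds (by beta_reduce; rw [w0, dw0]; exact huv))
    have ce : Filter.Tendsto e (nhds (u ^ 2 - v ^ 2)) (nhds 0) := by
      have := dinv.continuousAt.tendsto
      rwa [he0] at this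
    filter_upwards [hr, ce.eventually hpos] with z hz hz'
    simp only [Function.comp]
    rw [hπ _ _ hz', hz]
  let h : ℝ → ℝ := fun y => 2 * deriv π y
  have hfh : ∀ u v, 0 < u + v → v ≠ 0 → f u v = v * h (u ^ 2 - v ^ 2) := by
    intro u v huv hv
    simp only [h, (hder u v huv hv).deriv]
    field_simp
  have hcont : Continuous h := by
    rw [continuous_iff_continuousAt]
    intro y
    -- On the line `u + v = r` the point with `u² - v² = y` has `v = (r - y/r)/2`. A line is chosen
    -- on which `v ≠ 0` near `y`, so that `h` is the continuous quotient `f / v`.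
    obtain ⟨r, hr, hry⟩ : ∃ r : ℝ, 0 < r ∧ r - y / r ≠ 0 := by
      by_cases hy : y = 1
      · exact ⟨2, by norm_num, by rw [hy]; norm_num⟩
      · exact ⟨1, one_pos, fun h' => hy (by linarith)⟩
    have c1 : Continuous fun y => f ((r + y / r) / 2) ((r - y / r) / 2) :=
      continuous_uncurry_comp hf (by fun_prop) (by fun_prop)
    have c2 : Continuous fun y : ℝ => (r - y / r) / 2 := by fun_prop
    have hne : (r - y / r) / 2 ≠ 0 := div_ne_zero hry two_ne_zero
    refine (c1.continuousAt.div c2.continuousAt hne).congr ?_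
    filter_upwards [c2.continuousAt.eventually (isOpen_ne.mem_nhds hne)] with z hz
    have := hfh ((r + z / r) / 2) ((r - z / r) / 2) (by ring_nf; exact hr) hz
    simp only [Pi.div_apply]
    rw [this, mul_div_cancel_left₀ _ hz]
    congr 1
    field_simp
    ring
  refine ⟨h, hcont, fun u v huv => ?_⟩
  exact eq_of_eq_on_open_halfplane hf (B := fun u v => v * h (u ^ 2 - v ^ 2))
    (by simp only [Function.uncurry_def]; fun_prop) hfh huv

/-- Functions given on the two half-planes by functions of `u² - v²`. -/
theorem exists_branches_of_potential {f p : ℝ → ℝ → ℝ} (hf : Continuous (Function.uncurry f))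
    (hp : ∀ u, ContDiff ℝ ∞ u → ∀ x, HasDerivAt (fun x => p (u x) (deriv u x))
      (f (u x) (deriv u x) * helm u x) x) :
    ∃ fp fm : ℝ → ℝ, Continuous fp ∧ Continuous fm ∧ fp 0 = fm 0 ∧
      ∀ u v, f u v = v * ofBranches fp fm u v := by
  obtain ⟨fp, cfp, hfp⟩ := exists_invariant_of_potential hf hp
  -- The reflection `(u, v) ↦ (-u, -v)` carries the other half-plane to this one and preserves `u² -
  -- v²`.
  obtain ⟨fm, cfm, hfm⟩ := exists_invariant_of_potential (f := fun u v => -f (-u) (-v))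
    (p := fun u v => p (-u) (-v))
    ((continuous_uncurry_comp hf (X := ℝ × ℝ) (a := fun z => -z.1) (b := fun z => -z.2)
      (by fun_prop) (by fun_prop)).neg) (fun u hu x => by
      have := hp (fun x => -u x) hu.neg x
      have e1 : deriv (fun x => -u x) = fun x => -deriv u x := funext fun x => deriv.fun_neg
      have e2 : deriv (fun x => -deriv u x) = fun x => -deriv (deriv u) x :=
        funext fun x => deriv.fun_neg
      rw [helm_eq, e1, e2] at this
      refine this.congr_deriv ?_
      rw [helm_eq]; ring)
  have hfm' : ∀ u v, u + v ≤ 0 → f u v = v * fm (u ^ 2 - v ^ 2) := fun u v huv => by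
    have := hfm (-u) (-v) (by linarith)
    simp only [neg_neg, neg_sq] at this
    linarith
  refine ⟨fp, fm, cfp, cfm, ?_, fun u v => ?_⟩
  -- The point `(-1, 1)` lies on the common boundary line and has `v ≠ 0`, so the two branch
  -- functions can be compared at `0`.
  · have h1 := hfp (-1) 1 (by norm_num)
    have h2 := hfm' (-1) 1 (by norm_num)
    norm_num at h1 h2
    rw [← h1, ← h2]
  · unfold ofBranches
    split_ifs with h
    · exact hfp u v h
    · exact hfm' u v (not_le.1 h).le

/-! ### Fields that are first variations -/

/-- The field `u ↦ W u` is the first variation of a functional, given through its differences. -/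
def IsExactField (W : (ℝ → ℝ) → ℝ → ℝ) : Prop :=
  ∃ h : (ℝ → ℝ) → (ℝ → ℝ) → ℝ,
    (∀ u φ χ, ContDiff ℝ ∞ u → IsTest φ → IsTest χ →
      h u (fun y => φ y + χ y) = h u φ + h (fun y => u y + φ y) χ) ∧
    (∀ u φ, ContDiff ℝ ∞ u → IsTest φ →
      HasDerivAt (fun ε : ℝ => h u (fun y => ε * φ y)) (∫ x, W u x * φ x) 0)

/-- For compactly supported `φ` the difference `H(u + φ) - H(u)`, taken under the integral, is
finite even where `H(u)` is not, and it is additive along successive variations. -/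
theorem isExactField_of_density {k : ℕ} {B : ℝ → (Fin (k + 1) → ℝ) → ℝ}
    (hB : Continuous (Function.uncurry B)) {W : (ℝ → ℝ) → ℝ → ℝ}
    (hW : ∀ u, ContDiff ℝ ∞ u → ∀ φ, IsTest φ → HasDerivAt
      (fun ε : ℝ => ∫ x, (B x (jet k (fun y => u y + ε * φ y) x) - B x (jet k u x)))
      (∫ x, W u x * φ x) 0) : IsExactField W := by
  refine ⟨fun u φ => ∫ x, (B x (jet k (fun y => u y + φ y) x) - B x (jet k u x)), ?_,
    fun u φ hu hφ => hW u hu φ hφ⟩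
  have cj : ∀ u, ContDiff ℝ ∞ u → Continuous fun x => B x (jet k u x) := fun u hu =>
    hB.comp (continuous_id.prodMk (continuous_pi fun i =>
      (contDiff_infty.1 hu (i : ℕ)).continuous_iteratedDeriv _ le_rfl))
  have int : ∀ u φ, ContDiff ℝ ∞ u → IsTest φ →
      Integrable fun x => B x (jet k (fun y => u y + φ y) x) - B x (jet k u x) := by
    intro u φ hu hφ
    refine ((cj _ (hu.add hφ.1)).sub (cj u hu)).integrable_of_hasCompactSupport
      (HasCompactSupport.intro hφ.2 fun x hx => ?_)
    have : (fun y => u y + φ y) =ᶠ[nhds x] u := by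
      filter_upwards [notMem_tsupport_iff_eventuallyEq.1 hx] with y hy
      simp [hy]
    simp only [Pi.sub_apply]
    rw [jet_congr this, sub_self]
  intro u φ χ hu hφ hχ
  rw [← integral_add (int u φ hu hφ) (int _ χ (hu.add hφ.1) hχ)]
  simp only [add_assoc]
  congr 1
  funext x
  ring

theorem isExactField_const (c : ℝ) : IsExactField fun _ _ => c := by
  have int : ∀ {φ : ℝ → ℝ}, IsTest φ → Integrable φ :=
    fun hφ => hφ.1.continuous.integrable_of_hasCompactSupport hφ.2
  refine ⟨fun _ φ => c * ∫ x, φ x, fun u φ χ _ hφ hχ => ?_, fun u φ _ hφ => ?_⟩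
  · beta_reduce
    rw [integral_add (int hφ) (int hχ)]; ring
  · simp only [integral_const_mul]
    simpa [mul_comm] using ((hasDerivAt_id (0 : ℝ)).mul_const (∫ x, φ x)).const_mul c

theorem IsExactField.sub {W W' : (ℝ → ℝ) → ℝ → ℝ} (h : IsExactField W) (h' : IsExactField W')
    (hc : ∀ u, ContDiff ℝ ∞ u → Continuous (W u))
    (hc' : ∀ u, ContDiff ℝ ∞ u → Continuous (W' u)) :
    IsExactField fun u x => W u x - W' u x := by
  obtain ⟨A, a1, a2⟩ := h
  obtain ⟨A', a1', a2'⟩ := h'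
  refine ⟨fun u φ => A u φ - A' u φ, fun u φ χ hu hφ hχ => ?_, fun u φ hu hφ => ?_⟩
  · beta_reduce
    rw [a1 u φ χ hu hφ hχ, a1' u φ χ hu hφ hχ]; ring
  · simp only [sub_mul]
    rw [integral_sub]
    · exact (a2 u φ hu hφ).sub (a2' u φ hu hφ)
    · exact ((hc u hu).mul hφ.1.continuous).integrable_of_hasCompactSupport hφ.2.mul_left
    · exact ((hc' u hu).mul hφ.1.continuous).integrable_of_hasCompactSupport hφ.2.mul_left

theorem IsExactField.congr {W W' : (ℝ → ℝ) → ℝ → ℝ} (h : IsExactField W)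
    (e : ∀ u, ContDiff ℝ ∞ u → ∀ x, W u x = W' u x) : IsExactField W' := by
  obtain ⟨A, a1, a2⟩ := h
  refine ⟨A, a1, fun u φ hu hφ => ?_⟩
  simpa only [e u hu] using a2 u φ hu hφ

/-! ### Symmetry of the second variation and the form of g -/

/-- The mixed second difference quotient at a point where one partial derivative vanishes to
first order. -/
theorem tendsto_mixed_difference {H A C : ℝ → ℝ → ℝ} (hA : Continuous (Function.uncurry A))
    (hC : Continuous (Function.uncurry C))
    (hH : ∀ a b, HasDerivAt (H a) (a * A a b + b * C a b) b) :
    Filter.Tendsto (fun ε => (H ε ε - H ε 0 - H 0 ε + H 0 0) / ε ^ 2) (nhdsWithin 0 (Set.Ioi 0))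
      (nhds (A 0 0)) := by
  have hex : ∀ ε : ℝ, ∃ ξ : ℝ, 0 < ε → ξ ∈ Set.Ioo 0 ε ∧
      (H ε ε - H ε 0 - H 0 ε + H 0 0) / ε ^ 2
        = A ε ξ + ξ / ε * (C ε ξ - C 0 ξ) := by
    intro ε
    by_cases hε : 0 < ε
    -- The mean value theorem is applied in `b` to the increment in `a`. The term with `C` leaves a
    -- difference tending to `0`, with the factor `ξ / ε` below `1`, so continuity of `A` and `C` is
    -- enough.
    · have hd : ∀ b, HasDerivAt (fun b => H ε b - H 0 b)
          ((ε * A ε b + b * C ε b) - (0 * A 0 b + b * C 0 b)) b := fun b => (hH ε b).sub (hH 0 b)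
      obtain ⟨ξ, hξ, e⟩ := exists_hasDerivAt_eq_slope (fun b => H ε b - H 0 b) _ hε
        (fun b _ => (hd b).continuousAt.continuousWithinAt) (fun b _ => hd b)
      refine ⟨ξ, fun _ => ⟨hξ, ?_⟩⟩
      have hε' := hε.ne'
      have e1 : H ε ε - H ε 0 - H 0 ε + H 0 0
          = ε * ((ε * A ε ξ + ξ * C ε ξ) - (0 * A 0 ξ + ξ * C 0 ξ)) := by
        rw [e]; field_simp; ring
      rw [e1]; field_simp; ring
    · exact ⟨0, fun h => absurd h hε⟩
  choose ξ hξ using hex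
  have tε : Filter.Tendsto (fun ε : ℝ => ε) (nhdsWithin 0 (Set.Ioi 0)) (nhds 0) :=
    Filter.tendsto_id.mono_left nhdsWithin_le_nhds
  have tξ : Filter.Tendsto ξ (nhdsWithin 0 (Set.Ioi 0)) (nhds 0) := by
    refine tendsto_of_tendsto_of_tendsto_of_le_of_le' tendsto_const_nhds tε ?_ ?_
    · filter_upwards [self_mem_nhdsWithin] with ε hε using ((hξ ε hε).1.1).le
    · filter_upwards [self_mem_nhdsWithin] with ε hε using ((hξ ε hε).1.2).le
  have tA : Filter.Tendsto (fun ε => A ε (ξ ε)) (nhdsWithin 0 (Set.Ioi 0)) (nhds (A 0 0)) :=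
    (hA.tendsto (0, 0)).comp (tε.prodMk_nhds tξ)
  have tC : Filter.Tendsto (fun ε => C ε (ξ ε) - C 0 (ξ ε)) (nhdsWithin 0 (Set.Ioi 0))
      (nhds (C 0 0 - C 0 0)) :=
    ((hC.tendsto (0, 0)).comp (tε.prodMk_nhds tξ)).sub
      ((hC.tendsto (0, 0)).comp (tendsto_const_nhds.prodMk_nhds tξ))
  rw [sub_self] at tC
  have tP : Filter.Tendsto (fun ε => ξ ε / ε * (C ε (ξ ε) - C 0 (ξ ε)))
      (nhdsWithin 0 (Set.Ioi 0)) (nhds 0) := by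
    refine squeeze_zero_norm' ?_ (by simpa using tC.abs)
    filter_upwards [self_mem_nhdsWithin] with ε hε
    have hε' : 0 < ε := hε
    obtain ⟨⟨h1, h2⟩, -⟩ := hξ ε hε
    rw [norm_mul, Real.norm_eq_abs, Real.norm_eq_abs, abs_of_pos (div_pos h1 hε')]
    exact mul_le_of_le_one_left (abs_nonneg _) ((div_le_one hε').2 h2.le)
  have := tA.add tP
  rw [add_zero] at this
  refine this.congr' ?_
  filter_upwards [self_mem_nhdsWithin] with ε hε using ((hξ ε hε).2).symm

theorem helm_add_const_mul {u φ : ℝ → ℝ} (hu : ContDiff ℝ ∞ u) (hφ : ContDiff ℝ ∞ φ) (a x : ℝ) :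
    helm (fun y => u y + a * φ y) x = helm u x + a * helm φ x := by
  rw [helm_eq, helm_eq, helm_eq, deriv_add_const_mul hu hφ,
    deriv_add_const_mul (smooth_deriv hu) (smooth_deriv hφ)]
  ring

/-- The symmetry of the second variation at a function with `m = 0`. -/
theorem IsExactField.symm_of_helm_eq_zero {g : ℝ → ℝ → ℝ} (hg : Continuous (Function.uncurry g))
    (h : IsExactField fun u x => g (u x) (deriv u x) * helm u x) {u φ χ : ℝ → ℝ}
    (hu : ContDiff ℝ ∞ u) (hu0 : ∀ x, helm u x = 0) (hφ : IsTest φ) (hχ : IsTest χ) :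
    ∫ x, g (u x) (deriv u x) * helm φ x * χ x = ∫ x, g (u x) (deriv u x) * helm χ x * φ x := by
  obtain ⟨A, a1, a2⟩ := h
  let U : ℝ → ℝ → ℝ → ℝ := fun a b y => u y + (a * φ y + b * χ y)
  have hUs : ∀ a b, ContDiff ℝ ∞ (U a b) := fun a b =>
    hu.add ((hφ.const_mul a).add (hχ.const_mul b)).1
  have eU : ∀ a b, U a b = fun y => (u y + a * φ y) + b * χ y := fun a b => by
    funext y; simp only [U]; ring
  have hs : ∀ a, ContDiff ℝ ∞ fun y => u y + a * φ y := fun a => hu.add (hφ.const_mul a).1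
  have dU : ∀ a b x, deriv (U a b) x = deriv u x + a * deriv φ x + b * deriv χ x := by
    intro a b x
    rw [eU, deriv_add_const_mul (hs a) hχ.1, deriv_add_const_mul hu hφ.1]
  have mU : ∀ a b x, helm (U a b) x = a * helm φ x + b * helm χ x := by
    intro a b x
    rw [eU, helm_add_const_mul (hs a) hχ.1, helm_add_const_mul hu hφ.1, hu0, zero_add]
  have cu := hu.continuous
  have cu' := (smooth_deriv hu).continuous
  have cφ := hφ.1.continuous
  have cφ' := (smooth_deriv hφ.1).continuous
  have cχ := hχ.1.continuous
  have cχ' := (smooth_deriv hχ.1).continuous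
  let γ : (ℝ → ℝ) → (ℝ → ℝ) → ℝ → ℝ → ℝ := fun p r a b =>
    ∫ x, g (U a b x) (deriv (U a b) x) * helm p x * r x
  have cg : Continuous fun z : (ℝ × ℝ) × ℝ => g (U z.1.1 z.1.2 z.2) (deriv (U z.1.1 z.1.2) z.2) := by
    simp only [dU]
    exact continuous_uncurry_comp hg (by simp only [U]; fun_prop) (by fun_prop)
  have cγ : ∀ p r, IsTest p → IsTest r → Continuous (Function.uncurry (γ p r)) := by
    intro p r hp hr
    obtain ⟨R, hR, hs⟩ := hr.exists_bound
    have : Function.uncurry (γ p r) = fun z : ℝ × ℝ => ∫ x in (-R)..R,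
        g (U z.1 z.2 x) (deriv (U z.1 z.2) x) * helm p x * r x := by
      funext z
      refine integral_eq_intervalIntegral hR fun x hx => ?_
      rw [(eq_zero_of_notMem_tsupport (hs x hx)).1, mul_zero]
    rw [this]
    refine intervalIntegral.continuous_parametric_intervalIntegral_of_continuous'
      (f := fun (z : ℝ × ℝ) x => g (U z.1 z.2 x) (deriv (U z.1 z.2) x) * helm p x * r x) ?_ _ _
    exact (cg.mul ((continuous_helm hp.1).comp continuous_snd)).mul
      (hr.1.continuous.comp continuous_snd)
  have eγ : ∀ r, IsTest r → ∀ a b, ∫ x, g (U a b x) (deriv (U a b) x) * helm (U a b) x * r x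
      = a * γ φ r a b + b * γ χ r a b := by
    intro r hr a b
    have i : ∀ p, IsTest p →
        Integrable fun x => g (U a b x) (deriv (U a b) x) * helm p x * r x := fun p hp =>
      (((continuous_uncurry_comp hg (hUs a b).continuous (smooth_deriv (hUs a b)).continuous).mul
        (continuous_helm hp.1)).mul hr.1.continuous).integrable_of_hasCompactSupport
        hr.2.mul_left
    simp only [γ, mU]
    rw [← integral_const_mul, ← integral_const_mul,
      ← integral_add ((i φ hφ).const_mul a) ((i χ hχ).const_mul b)]
    congr 1
    funext x
    ring
  have aux : ∀ {k : ℝ → ℝ} {k' c b : ℝ}, HasDerivAt k k' 0 →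
      HasDerivAt (fun s => c + k (s - b)) k' b := by
    intro k k' c b hk
    have hk' : HasDerivAt k k' (id b - b) := by simpa using hk
    simpa [Function.comp_def] using (HasDerivAt.comp (h := fun s : ℝ => id s - b) (h₂ := k) b hk'
      ((hasDerivAt_id b).sub_const b)).const_add c
  let H : ℝ → ℝ → ℝ := fun a b => A u (fun y => a * φ y + b * χ y)
  -- Additivity moves the base point to `U a b`, turning the derivative at `0` into a partial
  -- derivative of `H` everywhere. Since `Δu = 0`, the momentum of `U a b` is `a Δφ + b Δχ`, which
  -- yields the form required for the mixed difference although `g` is only continuous.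
  have hH : ∀ a b, HasDerivAt (H a) (a * γ φ χ a b + b * γ χ χ a b) b := by
    intro a b
    have := aux (c := H a b) (b := b) (a2 (U a b) χ (hUs a b) hχ)
    rw [eγ χ hχ] at this
    refine this.congr_of_eventuallyEq (Filter.Eventually.of_forall fun s => ?_)
    simp only [H, U]
    rw [← a1 u _ _ hu ((hφ.const_mul a).add (hχ.const_mul b)) (hχ.const_mul (s - b))]
    congr 1
    funext y
    ring
  have hH' : ∀ b a, HasDerivAt (fun a => H a b) (b * γ χ φ a b + a * γ φ φ a b) a := by
    intro b a
    have := aux (c := H a b) (b := a) (a2 (U a b) φ (hUs a b) hφ)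
    rw [eγ φ hφ, add_comm] at this
    refine this.congr_of_eventuallyEq (Filter.Eventually.of_forall fun s => ?_)
    simp only [H, U]
    rw [← a1 u _ _ hu ((hφ.const_mul a).add (hχ.const_mul b)) (hφ.const_mul (s - a))]
    congr 1
    funext y
    ring
  have t1 := tendsto_mixed_difference (cγ φ χ hφ hχ) (cγ χ χ hχ hχ) hH
  have t2 := tendsto_mixed_difference (H := fun b a => H a b) (A := fun b a => γ χ φ a b)
    (C := fun b a => γ φ φ a b) ((cγ χ φ hχ hφ).comp continuous_swap)
    ((cγ φ φ hφ hφ).comp continuous_swap) hH'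
  have e : γ φ χ 0 0 = γ χ φ 0 0 := by
    refine tendsto_nhds_unique t1 (t2.congr fun ε => ?_)
    ring
  simpa [γ, U] using e

/-- If `g(u,u_x) m` is a first variation, then `g` is constant along the solutions of `u = u_xx`. -/
theorem IsExactField.const_on_hyperbolas {g : ℝ → ℝ → ℝ} (hg : Continuous (Function.uncurry g))
    (h : IsExactField fun u x => g (u x) (deriv u x) * helm u x) (α β x : ℝ) :
    g (α * Real.exp x + β * Real.exp (-x)) (α * Real.exp x + (-β) * Real.exp (-x))
      = g (α + β) (α + -β) := by
  let u : ℝ → ℝ := fun x => α * Real.exp x + β * Real.exp (-x)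
  have hu : ContDiff ℝ ∞ u := contDiff_exp_comb α β
  let k : ℝ → ℝ := fun x => g (u x) (deriv u x)
  have ck : Continuous k :=
    continuous_uncurry_comp hg hu.continuous (smooth_deriv hu).continuous
  have hsym : ∀ p χ : ℝ → ℝ, ContDiff ℝ ∞ p → IsTest χ →
      ∫ x, k x * (helm p x * χ x - p x * helm χ x) = 0 := by
    intro p χ hp hχ
    obtain ⟨R, hR, hs⟩ := hχ.exists_bound
    obtain ⟨η, hη, hη1⟩ := exists_test_eq_one hR
    have hφ := hη.mul_left hp
    -- Symmetry is available only for compactly supported variations; cutting `p` off outside the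
    -- support of `χ` allows arbitrary smooth `p`.
    have := h.symm_of_helm_eq_zero hg hu (helm_exp_comb α β) hφ hχ
    have i1 : Integrable fun x => k x * helm (fun x => p x * η x) x * χ x :=
      ((ck.mul (continuous_helm hφ.1)).mul hχ.1.continuous).integrable_of_hasCompactSupport
        hχ.2.mul_left
    have i2 : Integrable fun x => k x * helm χ x * (p x * η x) :=
      ((ck.mul (continuous_helm hχ.1)).mul hφ.1.continuous).integrable_of_hasCompactSupport
        hφ.2.mul_left
    have hz : ∫ x, (k x * helm (fun x => p x * η x) x * χ x - k x * helm χ x * (p x * η x)) = 0 := by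
      rw [integral_sub i1 i2]
      exact sub_eq_zero.2 this
    rw [← hz]
    congr 1
    funext x
    by_cases hx : x ∈ Set.Ioo (-R) R
    · have he : (fun x => p x * η x) =ᶠ[nhds x] p := by
        filter_upwards [isOpen_Ioo.mem_nhds hx] with y hy
        rw [hη1 y (abs_le.2 ⟨hy.1.le, hy.2.le⟩), mul_one]
      rw [helm_congr he, hη1 x (abs_le.2 ⟨hx.1.le, hx.2.le⟩)]
      ring
    · obtain ⟨z1, -, z3⟩ := eq_zero_of_notMem_tsupport (hs x hx)
      rw [z1, z3]
      ring
  obtain ⟨c, hc⟩ := eq_const_of_integral_deriv_test_eq_zero ck (fun χ hχ => by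
    have hxχ : IsTest fun x => x * χ x := hχ.mul_left contDiff_id
    -- With `p = 1` against `xχ` the symmetry gives `∫ k (2χ' + xχ'') = 0`, and with `p = x` against
    -- `χ` it gives `∫ k xχ'' = 0`. Subtracting, `k` has zero weak derivative.
    have h1 := hsym (fun _ => 1) _ contDiff_const hxχ
    have h2 := hsym (fun x => x) χ contDiff_id hχ
    have d1 : deriv (fun x => x * χ x) = fun x => χ x + x * deriv χ x := funext fun x => by
      refine (((hasDerivAt_id x).mul (smooth_hasDerivAt hχ.1 x)).congr_deriv ?_).deriv
      simp
    have d2 : deriv (fun x => χ x + x * deriv χ x)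
        = fun x => deriv χ x + (deriv χ x + x * deriv (deriv χ) x) := funext fun x => by
      refine (((smooth_hasDerivAt hχ.1 x).add ((hasDerivAt_id x).mul
        (smooth_hasDerivAt (smooth_deriv hχ.1) x))).congr_deriv ?_).deriv
      simp
    have e1 : ∀ x, helm (fun _ : ℝ => (1 : ℝ)) x = 1 := fun x => by simp [helm_eq]
    have e2 : ∀ x, helm (fun x : ℝ => x) x = x := fun x => by simp [helm_eq]
    have e3 : ∀ x, helm (fun x => x * χ x) x
        = x * χ x - (deriv χ x + (deriv χ x + x * deriv (deriv χ) x)) := fun x => by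
      rw [helm_eq, d1, d2]
    simp only [e1, e2, e3, helm_eq χ] at h1 h2
    have cχ := hχ.1.continuous
    have cχ' := (smooth_deriv hχ.1).continuous
    have cχ'' := (smooth_deriv (smooth_deriv hχ.1)).continuous
    have i1 : Integrable fun x => 2 * (k x * deriv χ x) :=
      ((ck.mul cχ').integrable_of_hasCompactSupport hχ.deriv.2.mul_left).const_mul 2
    have i2 : Integrable fun x => k x * (x * deriv (deriv χ) x) :=
      (ck.mul (continuous_id.mul cχ'')).integrable_of_hasCompactSupport
        hχ.deriv.deriv.2.mul_left.mul_left
    have r1 : ∀ x, k x * (1 * (x * χ x)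
        - 1 * (x * χ x - (deriv χ x + (deriv χ x + x * deriv (deriv χ) x))))
        = 2 * (k x * deriv χ x) + k x * (x * deriv (deriv χ) x) := fun x => by ring
    have r2 : ∀ x, k x * (x * χ x - x * (χ x - deriv (deriv χ) x))
        = k x * (x * deriv (deriv χ) x) := fun x => by ring
    simp only [r1] at h1
    simp only [r2] at h2
    rw [integral_add i1 i2, h2, integral_const_mul] at h1
    linarith)
  have h1 := hc x
  have h2 := hc 0
  simp only [k, u, deriv_exp_comb] at h1 h2
  rw [h1, ← h2]
  simp

/-- Restriction to the line `u + v = 1`, which meets each level set of `u² - v²` once, gives the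
function on one half-plane, and continuity extends it to the boundary. Reflection gives the other,
and the origin matches the two at `0`. -/
theorem exists_branches_of_const_on_hyperbolas {g : ℝ → ℝ → ℝ}
    (hg : Continuous (Function.uncurry g))
    (h : ∀ α β x : ℝ, g (α * Real.exp x + β * Real.exp (-x))
      (α * Real.exp x + (-β) * Real.exp (-x)) = g (α + β) (α + -β)) :
    ∃ gp gm : ℝ → ℝ, Continuous gp ∧ Continuous gm ∧ gp 0 = gm 0 ∧
      ∀ u v, g u v = ofBranches gp gm u v := by
  have half : ∀ g : ℝ → ℝ → ℝ, Continuous (Function.uncurry g) →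
      (∀ α β x : ℝ, g (α * Real.exp x + β * Real.exp (-x))
        (α * Real.exp x + (-β) * Real.exp (-x)) = g (α + β) (α + -β)) →
      ∃ k : ℝ → ℝ, Continuous k ∧ ∀ u v, 0 ≤ u + v → g u v = k (u ^ 2 - v ^ 2) := by
    intro g hg h
    have ck : Continuous fun y => g ((1 + y) / 2) ((1 - y) / 2) :=
      continuous_uncurry_comp hg (by fun_prop) (by fun_prop)
    refine ⟨_, ck, fun u v huv => ?_⟩
    exact eq_of_eq_on_open_halfplane hg
      (B := fun u v => g ((1 + (u ^ 2 - v ^ 2)) / 2) ((1 - (u ^ 2 - v ^ 2)) / 2))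
      (ck.comp (by fun_prop : Continuous fun z : ℝ × ℝ => z.1 ^ 2 - z.2 ^ 2))
      (fun u v huv _ => eq_of_const_on_hyperbolas h huv) huv
  obtain ⟨gp, cgp, hgp⟩ := half g hg h
  obtain ⟨gm, cgm, hgm⟩ := half (fun u v => g (-u) (-v))
    (continuous_uncurry_comp hg (X := ℝ × ℝ) (a := fun z => -z.1) (b := fun z => -z.2)
      (by fun_prop) (by fun_prop)) (fun α β x => by
      convert h (-α) (-β) x using 2 <;> ring)
  have hgm' : ∀ u v, u + v ≤ 0 → g u v = gm (u ^ 2 - v ^ 2) := fun u v huv => by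
    have := hgm (-u) (-v) (by linarith)
    simpa only [neg_neg, neg_sq] using this
  refine ⟨gp, gm, cgp, cgm, ?_, fun u v => ?_⟩
  · have h1 := hgp 0 0 (by norm_num)
    have h2 := hgm' 0 0 (by norm_num)
    norm_num at h1 h2
    rw [← h1, ← h2]
  · unfold ofBranches
    split_ifs with h
    · exact hgp u v h
    · exact hgm' u v (not_le.1 h).le

/-! ### Necessity assembled -/

/-- Every Hamiltonian equation has coefficients given by functions of `u² - v²` on each branch. -/
theorem HasHamiltonianStructure.exists_branches {f g : ℝ → ℝ → ℝ}
    (hf : Continuous (Function.uncurry f)) (hg : Continuous (Function.uncurry g))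
    (h : HasHamiltonianStructure f g) :
    ∃ fp fm gp gm : ℝ → ℝ,
      Continuous fp ∧ Continuous fm ∧ Continuous gp ∧ Continuous gm ∧
      fp 0 = fm 0 ∧ gp 0 = gm 0 ∧
      (∀ u v : ℝ, f u v = v * ofBranches fp fm u v) ∧
      (∀ u v : ℝ, g u v = u * ofBranches fp fm u v + ofBranches gp gm u v) := by
  obtain ⟨k, B, hB⟩ := h
  obtain ⟨W, hvar, hint, hloc⟩ := hB.exists_field hf hg
  let q : (ℝ → ℝ) → ℝ → ℝ := fun u x => W u x - g (u x) (deriv u x) * helm u x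
  obtain ⟨p, hp⟩ := exists_potential (q := q) hf hint (fun u w hu hw a ha => by
    simp only [q]
    rw [hloc u w hu hw a ha, ha.eq_of_nhds, ha.deriv_eq, helm_congr ha])
  have hpd : ∀ u, ContDiff ℝ ∞ u → ∀ x, HasDerivAt (fun x => p (u x) (deriv u x))
      (f (u x) (deriv u x) * helm u x) x := by
    intro u hu x
    have cfm : Continuous fun x => f (u x) (deriv u x) * helm u x :=
      (continuous_uncurry_comp hf hu.continuous (smooth_deriv hu).continuous).mul
        (continuous_helm hu)
    have := ((cfm.integral_hasStrictDerivAt 0 x).hasDerivAt).add_const (p (u 0) (deriv u 0))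
    refine this.congr_of_eventuallyEq (Filter.Eventually.of_forall fun z => ?_)
    have e := hint u hu 0 z
    have e0 := hp u hu 0
    have ez := hp u hu z
    simp only [q] at e0 ez
    simp only
    linarith
  obtain ⟨fp, fm, cfp, cfm, hf0, hff⟩ := exists_branches_of_potential hf hpd
  have cF := continuous_ofBranches_primitive cfp cfm
  have cf1 := continuous_ofBranches cfp cfm hf0
  set F := ofBranches (primitive fp) (primitive fm) with hF
  -- the potential is `½ F` up to a constant
  have hpF : ∀ a b, p a b = 1 / 2 * F a b + p 0 0 := by
    intro a b
    -- Both potentials have the same derivative along the cubic joining the zero 1-jet to `(a, b)`.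
    have hu := contDiff_hermite a b 0
    have d : ∀ x, HasDerivAt (fun x => p (hermite a b 0 x) (deriv (hermite a b 0) x)
        - 1 / 2 * F (hermite a b 0 x) (deriv (hermite a b 0) x)) 0 x := fun x => by
      refine ((hpd _ hu x).sub (hasDerivAt_ofBranches_primitive cfp cfm hf0 hu x)).congr_deriv ?_
      rw [hff]; ring
    have := is_const_of_deriv_eq_zero (fun x => (d x).differentiableAt) (fun x => (d x).deriv) 0 (-1)
    have F0 : F 0 0 = 0 := by simp [hF, ofBranches, primitive_zero]
    have e1 : hermite a b 0 0 = a := by simp [hermite]; ring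
    have e2 : hermite a b 0 (-1) = 0 := by simp [hermite]
    have e3 : deriv (hermite a b 0) 0 = b := by rw [deriv_hermite]; simp; ring
    have e4 : deriv (hermite a b 0) (-1) = 0 := by rw [deriv_hermite]; simp
    rw [e1, e2, e3, e4, F0] at this
    linarith
  have hWeq : ∀ u, ContDiff ℝ ∞ u → ∀ x, W u x = g (u x) (deriv u x) * helm u x
      + 1 / 2 * F (u x) (deriv u x) + p 0 0 := by
    intro u hu x
    have := hp u hu x
    rw [hpF] at this
    simp only [q] at this
    linarith
  have cW : ∀ u, ContDiff ℝ ∞ u → Continuous (W u) := by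
    intro u hu
    rw [funext (hWeq u hu)]
    exact (((continuous_uncurry_comp hg hu.continuous (smooth_deriv hu).continuous).mul
      (continuous_helm hu)).add (continuous_const.mul
      (continuous_uncurry_comp cF hu.continuous (smooth_deriv hu).continuous))).add continuous_const
  have c0 : Continuous fun _ : ℝ => (0 : ℝ) := continuous_const
  have cz : Continuous (Function.uncurry (ofBranches (fun _ => 0) fun _ => 0)) :=
    continuous_ofBranches c0 c0 rfl
  -- The first variation `u f₁ m + ½ F₁` of the Hamiltonian with `g₁ = 0`. Subtracting it and the
  -- constant `p 0 0` from `W` leaves exactly `(g - u f₁) m`.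
  let W₀ : (ℝ → ℝ) → ℝ → ℝ := fun u x => varDeriv (ofBranches fp fm)
    (ofBranches (fun _ => 0) fun _ => 0) F (u x) (deriv u x) (deriv (deriv u) x)
  have cW₀ : ∀ u, ContDiff ℝ ∞ u → Continuous (W₀ u) := fun u hu =>
    continuous_varDeriv_comp cf1 cz cF hu.continuous (smooth_deriv hu).continuous
      (smooth_deriv (smooth_deriv hu)).continuous
  have ex₀ : IsExactField W₀ :=
    isExactField_of_density (isHamiltonianDensity_ofBranches cfp cfm c0 c0 hf0 rfl).1
      fun u hu φ hφ => hasDerivAt_integral_density cfp cfm c0 c0 hf0 rfl hu hφ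
  have ex : IsExactField fun u x =>
      (g (u x) (deriv u x) - u x * ofBranches fp fm (u x) (deriv u x)) * helm u x := by
    refine (((isExactField_of_density hB.1 hvar).sub ex₀ cW cW₀).sub (isExactField_const (p 0 0))
      (fun u hu => (cW u hu).sub (cW₀ u hu)) (fun _ _ => continuous_const)).congr fun u hu x => ?_
    simp only [hWeq u hu, W₀, varDeriv, ofBranches_self, ofInvariant, helm_eq]
    ring
  have cg1 : Continuous (Function.uncurry fun u v => g u v - u * ofBranches fp fm u v) :=
    hg.sub (continuous_fst.mul cf1)
  obtain ⟨gp, gm, cgp, cgm, hg0, hgg⟩ := exists_branches_of_const_on_hyperbolas cg1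
    (IsExactField.const_on_hyperbolas cg1 ex)
  exact ⟨fp, fm, gp, gm, cfp, cfm, cgp, cgm, hf0, hg0, hff, fun u v => by rw [← hgg]; ring⟩

/-! ### Regularity of g₁ -/

/-- In `g = u a(u² - v²) + b(u² - v²)` the function `b` is as smooth as `g`. -/
theorem contDiff_of_eq_on_halfplane {g : ℝ → ℝ → ℝ} (hg : ContDiff ℝ 1 (Function.uncurry g))
    {a b : ℝ → ℝ} (h : ∀ u v, 0 < u + v → g u v = u * a (u ^ 2 - v ^ 2) + b (u ^ 2 - v ^ 2)) :
    ContDiff ℝ 1 b := by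
  have hc : ∀ r : ℝ, ContDiff ℝ 1 fun y => g ((r + y / r) / 2) ((r - y / r) / 2) := fun r =>
    hg.comp (f := fun y : ℝ => ((r + y / r) / 2, (r - y / r) / 2)) (by fun_prop)
  have hv : ∀ r, 0 < r → ∀ y, g ((r + y / r) / 2) ((r - y / r) / 2)
      = (r + y / r) / 2 * a y + b y := by
    intro r hr y
    rw [h _ _ (by ring_nf; exact hr)]
    have : ((r + y / r) / 2) ^ 2 - ((r - y / r) / 2) ^ 2 = y := by field_simp; ring
    rw [this]
  rw [contDiff_iff_contDiffAt]
  intro y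
  -- The lines `u + v = 1` and `u + v = r` meet the level `y` at points whose `u`-coordinates differ
  -- by `(r - 1)(r - y) / (2r)`. With this nonzero, the two values of `g` form a linear system that
  -- is solved for `b`, without differentiating `a`.
  obtain ⟨r, hr, hry⟩ : ∃ r : ℝ, 1 < r ∧ y ≠ r := by
    by_cases hy : y = 2
    · exact ⟨3, by norm_num, by rw [hy]; norm_num⟩
    · exact ⟨2, by norm_num, hy⟩
  have hr0 : 0 < r := by linarith
  have key : ∀ z : ℝ, z ≠ r → (r + z / r) / 2 - (1 + z / 1) / 2 ≠ 0 := by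
    intro z hz h'
    have : (r - 1) * (r - z) = 0 := by
      field_simp at h'
      linarith
    rcases mul_eq_zero.1 this with h1 | h1
    · linarith
    · exact hz (by linarith)
  have hcd : ContDiffAt ℝ 1 (fun z => ((r + z / r) / 2 * g ((1 + z / 1) / 2) ((1 - z / 1) / 2)
      - (1 + z / 1) / 2 * g ((r + z / r) / 2) ((r - z / r) / 2))
      / ((r + z / r) / 2 - (1 + z / 1) / 2)) y := by
    refine ContDiffAt.div (ContDiff.contDiffAt ?_) (ContDiff.contDiffAt (by fun_prop)) (key y hry)
    exact (ContDiff.mul (by fun_prop) (hc 1)).sub (ContDiff.mul (by fun_prop) (hc r))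
  refine hcd.congr_of_eventuallyEq ?_
  filter_upwards [isOpen_ne.mem_nhds hry] with z hz
  rw [eq_div_iff (key z hz), hv 1 one_pos, hv r hr0]
  ring

theorem contDiff_branches {g : ℝ → ℝ → ℝ} (hg : ContDiff ℝ 1 (Function.uncurry g))
    {fp fm gp gm : ℝ → ℝ}
    (h : ∀ u v : ℝ, g u v = u * ofBranches fp fm u v + ofBranches gp gm u v) :
    ContDiff ℝ 1 gp ∧ ContDiff ℝ 1 gm := by
  refine ⟨contDiff_of_eq_on_halfplane hg (a := fp) fun u v huv => ?_,
    contDiff_of_eq_on_halfplane (g := fun u v => g (-u) (-v)) (a := fun y => -fm y)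
      (hg.comp (f := fun z : ℝ × ℝ => (-z.1, -z.2)) (by fun_prop)) fun u v huv => ?_⟩
  · simp [h, ofBranches, huv.le]
  · have : ¬ (0 ≤ -u + -v) := by linarith
    simp [h, ofBranches, this]

/-! ### Agreement of the branches in the analytic case -/

theorem eq_of_eq_compl_one {a b : ℝ → ℝ} (ha : Continuous a) (hb : Continuous b)
    (h : ∀ t, t ≠ 1 → a t = b t) : a = b :=
  Continuous.ext_on (dense_compl_singleton (1 : ℝ)) ha hb fun t ht => h t ht

theorem analytic_comp₂ {f : ℝ → ℝ → ℝ}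
    (hf : AnalyticOnNhd ℝ (Function.uncurry f) Set.univ) {a b : ℝ → ℝ}
    (ha : AnalyticOnNhd ℝ a Set.univ) (hb : AnalyticOnNhd ℝ b Set.univ) :
    AnalyticOnNhd ℝ (fun t => f (a t) (b t)) Set.univ :=
  hf.comp (g := Function.uncurry f) (f := fun t => (a t, b t)) (ha.prod hb) fun _ _ => trivial

/-- For analytic coefficients the functions on the two branches agree. -/
theorem branches_eq_of_analytic {f g : ℝ → ℝ → ℝ}
    (hf : AnalyticOnNhd ℝ (Function.uncurry f) Set.univ)
    (hg : AnalyticOnNhd ℝ (Function.uncurry g) Set.univ) {fp fm gp gm : ℝ → ℝ}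
    (cfp : Continuous fp) (cfm : Continuous fm) (cgp : Continuous gp) (cgm : Continuous gm)
    (hff : ∀ u v : ℝ, f u v = v * ofBranches fp fm u v)
    (hgg : ∀ u v : ℝ, g u v = u * ofBranches fp fm u v + ofBranches gp gm u v) :
    fp = fm ∧ gp = gm := by
  have an1 : AnalyticOnNhd ℝ (fun t : ℝ => (1 + t) / 2) Set.univ := fun t _ => by fun_prop
  have an2 : AnalyticOnNhd ℝ (fun t : ℝ => (1 - t) / 2) Set.univ := fun t _ => by fun_prop
  have an3 : AnalyticOnNhd ℝ (fun t : ℝ => (t - 1) / 2) Set.univ := fun t _ => by fun_prop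
  have an4 : AnalyticOnNhd ℝ (fun t : ℝ => -(1 + t) / 2) Set.univ := fun t _ => by fun_prop
  -- the values of `ofBranches` on three lines
  have v1 : ∀ (hp hm : ℝ → ℝ) (t : ℝ), ofBranches hp hm ((1 + t) / 2) ((1 - t) / 2) = hp t := by
    intro hp hm t
    have h1 : (0 : ℝ) ≤ (1 + t) / 2 + (1 - t) / 2 := by ring_nf; norm_num
    have h2 : ((1 + t) / 2) ^ 2 - ((1 - t) / 2) ^ 2 = t := by ring
    simp only [ofBranches, h1, h2, if_true]
  have v2 : ∀ (hp hm : ℝ → ℝ) (t : ℝ), ofBranches hp hm ((1 + t) / 2) ((t - 1) / 2)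
      = if 0 ≤ t then hp t else hm t := by
    intro hp hm t
    have h1 : (1 + t) / 2 + (t - 1) / 2 = t := by ring
    have h2 : ((1 + t) / 2) ^ 2 - ((t - 1) / 2) ^ 2 = t := by ring
    simp only [ofBranches, h1, h2]
  have v3 : ∀ (hp hm : ℝ → ℝ) (t : ℝ), ofBranches hp hm (-(1 + t) / 2) ((t - 1) / 2) = hm t := by
    intro hp hm t
    have h1 : ¬ (0 : ℝ) ≤ -(1 + t) / 2 + (t - 1) / 2 := by ring_nf; norm_num
    have h2 : (-(1 + t) / 2) ^ 2 - ((t - 1) / 2) ^ 2 = t := by ring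
    simp only [ofBranches, h1, h2, if_false]
  have evp : ∀ᶠ t in nhds (1 : ℝ), 0 ≤ t := (lt_mem_nhds one_pos).mono fun _ h => h.le
  have evm : ∀ᶠ t in nhds (-1 : ℝ), ¬ 0 ≤ t :=
    (gt_mem_nhds (by norm_num : (-1 : ℝ) < 0)).mono fun _ h => not_le.2 h
  have A1 := analytic_comp₂ hf an1 an2
  have A2 := analytic_comp₂ hf an1 an3
  have A3 := analytic_comp₂ hf an4 an3
  have B1 := analytic_comp₂ hg an1 an2
  have B2 := analytic_comp₂ hg an1 an3
  have B3 := analytic_comp₂ hg an4 an3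
  -- For `t ≥ 0` the first two lines lie on the same branch and have opposite `v`, so `f` takes
  -- opposite values; by analyticity this persists for `t < 0`, where the second line is on the
  -- other branch.
  have efm : ∀ t, ¬ 0 ≤ t → fp t = fm t := by
    have := AnalyticOnNhd.eq_of_eventuallyEq A1 A2.neg (z₀ := 1) (by
      filter_upwards [evp] with t ht
      simp only [Pi.neg_apply, hff, v1, v2, ht, if_true]; ring)
    intro t ht
    have e := congrFun this t
    simp only [Pi.neg_apply, hff, v1, v2, ht, if_false] at e
    have ht' : (1 - t) / 2 ≠ 0 := by
      rw [not_le] at ht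
      linarith
    exact mul_left_cancel₀ ht' (by rw [e]; ring)
  have ef : fp = fm := by
    refine eq_of_eq_compl_one cfp cfm fun t ht => ?_
    by_cases ht0 : 0 ≤ t
    -- For `t < 0` the last two lines share branch and `v`; continuing to `t ≥ 0` separates the
    -- branches. The point `t = 1`, where `v = 0`, is left to continuity.
    · have := AnalyticOnNhd.eq_of_eventuallyEq A2 A3 (z₀ := -1) (by
        filter_upwards [evm] with t ht
        simp only [hff, v2, v3, ht, if_false])
      have e := congrFun this t
      simp only [hff, v2, v3, ht0, if_true] at e
      exact mul_left_cancel₀ (div_ne_zero (sub_ne_zero.2 ht) two_ne_zero) e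
    · exact efm t ht0
  subst ef
  refine ⟨rfl, eq_of_eq_compl_one cgp cgm fun t ht => ?_⟩
  by_cases ht0 : 0 ≤ t
  · have an5 : AnalyticOnNhd ℝ (fun t : ℝ => 1 - t) Set.univ := fun t _ => by fun_prop
    have an6 : AnalyticOnNhd ℝ (fun t : ℝ => 2 * (1 + t)) Set.univ := fun t _ => by fun_prop
    -- The last two lines have opposite `u`, so for `t < 0` the difference of the values of `g` is
    -- `(1 + t) f₁`. Since `f = (1 - t) f₁ / 2` on the first line, clearing `1 - t` gives a relation
    -- among analytic functions only, `f₁` itself being known just to be continuous.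
    have := AnalyticOnNhd.eq_of_eventuallyEq (an5.mul (B2.sub B3)) (an6.mul A1) (z₀ := -1) (by
      filter_upwards [evm] with t ht
      simp only [Pi.sub_apply, hff, hgg, v1, v2, v3, ht, if_false]; ring)
    have e := congrFun this t
    simp only [Pi.sub_apply, hff, hgg, v1, v2, v3, ht0, if_true] at e
    refine mul_left_cancel₀ (sub_ne_zero.2 ht.symm) (a := 1 - t) ?_
    linarith
  · have := AnalyticOnNhd.eq_of_eventuallyEq B1 B2 (z₀ := 1) (by
      filter_upwards [evp] with t ht
      simp only [hgg, v1, v2, ht, if_true])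
    have e := congrFun this t
    simp only [hgg, v1, v2, ht0, if_false, ite_self] at e
    linarith

end CHmCH

end

/-! ### The main theorem -/

theorem mainTheorem4 :
    -- classification of all continuous `f`, `g` on the plane
    (∀ f g : ℝ → ℝ → ℝ,
      Continuous (Function.uncurry f) → Continuous (Function.uncurry g) →
      (CHmCH.HasHamiltonianStructure f g ↔
        ∃ fp fm gp gm : ℝ → ℝ,
          Continuous fp ∧ Continuous fm ∧ Continuous gp ∧ Continuous gm ∧
          fp 0 = fm 0 ∧ gp 0 = gm 0 ∧
          (ContDiff ℝ 1 (Function.uncurry g) → ContDiff ℝ 1 gp ∧ ContDiff ℝ 1 gm) ∧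
          (∀ u v : ℝ, f u v = v * CHmCH.ofBranches fp fm u v) ∧
          (∀ u v : ℝ,
            g u v = u * CHmCH.ofBranches fp fm u v + CHmCH.ofBranches gp gm u v))) ∧
    -- classification of all analytic `f`, `g` on the plane
    (∀ f g : ℝ → ℝ → ℝ,
      AnalyticOnNhd ℝ (Function.uncurry f) Set.univ →
      AnalyticOnNhd ℝ (Function.uncurry g) Set.univ →
      (CHmCH.HasHamiltonianStructure f g ↔
        ∃ f₁ g₁ : ℝ → ℝ, Continuous f₁ ∧ ContDiff ℝ 1 g₁ ∧
          (∀ u v : ℝ, f u v = v * f₁ (u ^ 2 - v ^ 2)) ∧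
          (∀ u v : ℝ, g u v = u * f₁ (u ^ 2 - v ^ 2) + g₁ (u ^ 2 - v ^ 2)))) ∧
    -- the Hamiltonian for functions `f₁`, `g₁` of `u² - u_x²`
    (∀ f₁ g₁ : ℝ → ℝ, Continuous f₁ → Continuous g₁ →
      CHmCH.IsHamiltonianDensity
        (fun u v => v * f₁ (u ^ 2 - v ^ 2))
        (fun u v => u * f₁ (u ^ 2 - v ^ 2) + g₁ (u ^ 2 - v ^ 2))
        (CHmCH.density (CHmCH.ofInvariant (CHmCH.primitive f₁))
          (CHmCH.ofInvariant (CHmCH.average g₁))) ∧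
      CHmCH.IsSchwartzHamiltonian
        (fun u v => v * f₁ (u ^ 2 - v ^ 2))
        (fun u v => u * f₁ (u ^ 2 - v ^ 2) + g₁ (u ^ 2 - v ^ 2))
        (CHmCH.density (CHmCH.ofInvariant (CHmCH.primitive f₁))
          (CHmCH.ofInvariant (CHmCH.average g₁))) ∧
      (∀ y : ℝ, CHmCH.primitive f₁ y = y * ∫ s in (0 : ℝ)..1, f₁ (s * y)) ∧
      (∀ y : ℝ, y ≠ 0 → CHmCH.average g₁ y = y⁻¹ * ∫ t in (0 : ℝ)..y, g₁ t)) ∧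
    -- the Hamiltonian when `f₁`, `g₁` differ on the two branches of the level sets
    (∀ fp fm gp gm : ℝ → ℝ,
      Continuous fp → Continuous fm → Continuous gp → Continuous gm →
      fp 0 = fm 0 → gp 0 = gm 0 →
      CHmCH.IsHamiltonianDensity
        (fun u v => v * CHmCH.ofBranches fp fm u v)
        (fun u v => u * CHmCH.ofBranches fp fm u v + CHmCH.ofBranches gp gm u v)
        (CHmCH.density (CHmCH.ofBranches (CHmCH.primitive fp) (CHmCH.primitive fm))
          (CHmCH.ofBranches (CHmCH.average gp) (CHmCH.average gm))) ∧
      CHmCH.IsSchwartzHamiltonian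
        (fun u v => v * CHmCH.ofBranches fp fm u v)
        (fun u v => u * CHmCH.ofBranches fp fm u v + CHmCH.ofBranches gp gm u v)
        (CHmCH.density (CHmCH.ofBranches (CHmCH.primitive fp) (CHmCH.primitive fm))
          (CHmCH.ofBranches (CHmCH.average gp) (CHmCH.average gm)))) := by
  refine ⟨fun f g hf hg => ⟨fun h => ?_, ?_⟩, fun f g hf hg => ⟨fun h => ?_, ?_⟩,
    fun f₁ g₁ hf hg => ⟨?_, ?_, fun y => (CHmCH.mul_average f₁ y).symm, fun y hy => ?_⟩,
    fun fp fm gp gm h1 h2 h3 h4 h5 h6 =>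
      ⟨CHmCH.isHamiltonianDensity_ofBranches h1 h2 h3 h4 h5 h6,
        CHmCH.isSchwartzHamiltonian_ofBranches h1 h2 h3 h4 h5 h6⟩⟩
  · obtain ⟨fp, fm, gp, gm, h1, h2, h3, h4, h5, h6, h7, h8⟩ := h.exists_branches hf hg
    exact ⟨fp, fm, gp, gm, h1, h2, h3, h4, h5, h6, fun hc => CHmCH.contDiff_branches hc h8, h7, h8⟩
  · rintro ⟨fp, fm, gp, gm, h1, h2, h3, h4, h5, h6, -, h7, h8⟩
    obtain rfl : f = fun u v => v * CHmCH.ofBranches fp fm u v := funext₂ h7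
    obtain rfl : g = fun u v => u * CHmCH.ofBranches fp fm u v + CHmCH.ofBranches gp gm u v :=
      funext₂ h8
    exact ⟨2, _, CHmCH.isHamiltonianDensity_ofBranches h1 h2 h3 h4 h5 h6⟩
  · obtain ⟨fp, fm, gp, gm, h1, h2, h3, h4, -, -, h7, h8⟩ :=
      h.exists_branches hf.continuous hg.continuous
    obtain ⟨rfl, rfl⟩ := CHmCH.branches_eq_of_analytic hf hg h1 h2 h3 h4 h7 h8
    have hc : ContDiff ℝ 1 (Function.uncurry g) := hg.contDiff
    refine ⟨fp, gp, h1, (CHmCH.contDiff_branches hc h8).1, fun u v => ?_, fun u v => ?_⟩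
    · rw [h7, CHmCH.ofBranches_self, CHmCH.ofInvariant]
    · rw [h8, CHmCH.ofBranches_self, CHmCH.ofBranches_self, CHmCH.ofInvariant, CHmCH.ofInvariant]
  · rintro ⟨f₁, g₁, h1, h2, h7, h8⟩
    obtain rfl : f = fun u v => v * f₁ (u ^ 2 - v ^ 2) := funext₂ h7
    obtain rfl : g = fun u v => u * f₁ (u ^ 2 - v ^ 2) + g₁ (u ^ 2 - v ^ 2) := funext₂ h8
    have := CHmCH.isHamiltonianDensity_ofBranches h1 h1 h2.continuous h2.continuous rfl rfl
    simp only [CHmCH.ofBranches_self] at this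
    exact ⟨2, _, this⟩
  · have := CHmCH.isHamiltonianDensity_ofBranches hf hf hg hg rfl rfl
    simp only [CHmCH.ofBranches_self] at this
    exact this
  · have := CHmCH.isSchwartzHamiltonian_ofBranches hf hf hg hg rfl rfl
    simp only [CHmCH.ofBranches_self] at this
    exact this
  · rw [← CHmCH.mul_average, inv_mul_cancel_left₀ hy]
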